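/- **Setting.** For real $a,b,c$ the *Apollonian depth* $\delta(a,b,c)\in\{0,1,2,\dots\}\cup\{\infty\}$ is the number of steps after which a zero or negative entry first occurs, when one repeatedly replaces a greatest entry of the triple $(a,b,c)$ by $a+b+c-2\sqrt{ab+bc+ca}$ (it is $0$ if an entry is already $\le 0$, and $\infty$ if no such entry ever occurs). Put $\delta(x,y)=\delta(1,x,y)$. A *plateau of value* $k$ (with $0\le k<\infty$) is a connected component of the level set $\{\delta=k\}$ in the unit square $[0,1]^2$. The Stern–Brocot array has row $0$ equal to $(1,0),(0,1)$, and each further row arises from the preceding one by inserting between neighbours their vector sum; the *row number* of $(p,m)$ is the index of the first row containing it (so the root $(1,1)$ of the Stern–Brocot tree has row number $1$). **Theorem 1.** For every reduced fraction $p/m\in[0,1]$ let $E[p,m]$ be the curve $$\Bigl(\tfrac{m}{p}\,x+\tfrac{p^2+m^2-1}{pm}\,y\Bigr)^2+\tfrac{p^2}{m^2}=4xy+2x+2\,\tfrac{m^2-p^2+1}{m^2}\,y ,$$ where for $p=0$, $m=1$ the equation is first multiplied by $p^2$, so that $E[0,1]$ is the line $x=0$. The interior of $E[p,m]$ is the set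 where the left side is smaller than the right side (empty for $E[0,1]$). **(A)** $E[p,m]$ is an ellipse if $p\ge1$ and $m\ge 2$, and $E[1,1]$ is a parabola, each with the interior just described. Every $E[p,m]$ meets the $x$-axis exactly in the point $(p^2/m^2,0)$; if $p\ge1$, then $E[p,m]$ with its interior lies in $y\ge0$ and $E[p,m]$ is tangent to the $x$-axis at that point. **(B)** The interiors of two different curves are disjoint. If $\det\begin{bmatrix}p&q\\m&n\end{bmatrix}=\pm1$, then $(p+q)/(m+n)$ is again a reduced fraction in $[0,1]$, and $E[p+q,m+n]$ is an ellipse inscribed between $E[p,m]$, $E[q,n]$ and the $x$-axis: it lies in the bounded gap enclosed by these three, is tangent to $E[p,m]$ and to $E[q,n]$, and is tangent to the $x$-axis at $\bigl((p+q)^2/(m+n)^2,0\bigr)$. **(C)** If $\det\begin{bmatrix}p&q\\m&n\end{bmatrix}=\pm1$, then $E[p,m]$ and $E[q,n]$ are tangent to each other at the point $$E[p,m]\cap E[q,n]=\Bigl(\frac{p^2+q^2-1}{m^2+n^2-1},\ \frac{1}{m^2+n^2-1}\Bigr),$$ which is their only common point. **(D)** Let $p\ge1$ and let $k$ be the row number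 of $(p,m)$. Then $\delta=k$ on the interior of $E[p,m]$, and there is a plateau of value $k$ that coincides with $E[p,m]$, in the sense that it contains the part in $[0,1]^2$ of the interior of $E[p,m]$ and is contained in $E[p,m]$ together with its interior. If $m\ge 2$, then $E[p,m]$ with its interior lies in $[0,1]^2$. Conversely, every plateau of value $k\ge1$ whose closure meets the $x$-axis coincides in this sense with $E[p,m]$ for some reduced $p/m\in(0,1]$ with row number $k$. Finally, $\delta=0$, the row number of $(0,1)$, on the line $E[0,1]$. -/

import Mathlib

/-! The curves `E[p,m]` and their interiors. -/

/-- `p/m`, and hence `p²/m²`, is a reduced fraction in `[0,1]` (so `m ≥ 1`). -/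
def Reduced (p m : ℕ) : Prop := Nat.Coprime p m ∧ p ≤ m

/-- Left side minus right side of the equation
`((m/p) x + ((p²+m²-1)/(pm)) y)² + p²/m² = 4xy + 2x + 2 ((m²-p²+1)/m²) y` (for `p, m ≠ 0`). -/
noncomputable def form (p m : ℕ) (z : ℝ × ℝ) : ℝ :=
  (((m : ℝ) / p * z.1 + ((p : ℝ) ^ 2 + (m : ℝ) ^ 2 - 1) / ((p : ℝ) * m) * z.2) ^ 2
      + (p : ℝ) ^ 2 / (m : ℝ) ^ 2)
    - (4 * z.1 * z.2 + 2 * z.1 + 2 * (((m : ℝ) ^ 2 - (p : ℝ) ^ 2 + 1) / (m : ℝ) ^ 2) * z.2)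

/-- The curve `E[p,m]`. For `p = 0` (hence `m = 1`) the equation, multiplied through by `p²`, reads
`x² = 0`, and `E[0,1]` is the vertical line `x = 0`. -/
def E (p m : ℕ) : Set (ℝ × ℝ) := {z | (p = 0 ∧ z.1 = 0) ∨ (p ≠ 0 ∧ form p m z = 0)}

/-- The open interior of `E[p,m]` (empty for the line `E[0,1]`). -/
def inside (p m : ℕ) : Set (ℝ × ℝ) := {z | p ≠ 0 ∧ form p m z < 0}

/-- The closed region bounded by `E[p,m]`. -/
def region (p m : ℕ) : Set (ℝ × ℝ) := E p m ∪ inside p m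

/-- `C` is an ellipse with interior `I`: some invertible affine map of the plane carries the unit
circle onto `C` and the open unit disk onto `I`. -/
def IsEllipse (C I : Set (ℝ × ℝ)) : Prop :=
  ∃ φ : (ℝ × ℝ) ≃ᵃ[ℝ] (ℝ × ℝ),
    φ '' {w | w.1 ^ 2 + w.2 ^ 2 = 1} = C ∧ φ '' {w | w.1 ^ 2 + w.2 ^ 2 < 1} = I

/-- `C` is a parabola with convex side `I`. -/
def IsParabola (C I : Set (ℝ × ℝ)) : Prop :=
  ∃ φ : (ℝ × ℝ) ≃ᵃ[ℝ] (ℝ × ℝ),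
    φ '' {w | w.2 = w.1 ^ 2} = C ∧ φ '' {w | w.1 ^ 2 < w.2} = I

def xAxis : Set (ℝ × ℝ) := {z | z.2 = 0}

/-- `v ≠ 0` is a tangent direction of the curve `C` at `P`: it is the velocity at `P` of a motion
along `C`. -/
def HasTangent (C : Set (ℝ × ℝ)) (P v : ℝ × ℝ) : Prop :=
  v ≠ 0 ∧ ∃ γ : ℝ → ℝ × ℝ, γ 0 = P ∧ (∀ t, γ t ∈ C) ∧ HasDerivAt γ v 0

/-- The curves `C` and `D` are tangent at `P`: both pass through `P`, with a common tangent
direction. -/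
def TangentAt (C D : Set (ℝ × ℝ)) (P : ℝ × ℝ) : Prop :=
  ∃ v, HasTangent C P v ∧ HasTangent D P v

/-- The point of the `x`-axis over which `E[p,m]` stands. -/
noncomputable def axisPoint (p m : ℕ) : ℝ × ℝ := ((p : ℝ) ^ 2 / (m : ℝ) ^ 2, 0)

noncomputable def tangencyPoint (p m q n : ℕ) : ℝ × ℝ :=
  (((p : ℝ) ^ 2 + (q : ℝ) ^ 2 - 1) / ((m : ℝ) ^ 2 + (n : ℝ) ^ 2 - 1),
    1 / ((m : ℝ) ^ 2 + (n : ℝ) ^ 2 - 1))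

/-- `det [[p,q],[m,n]] = ±1`. -/
def DetOne (p m q n : ℕ) : Prop :=
  (!![(p : ℤ), (q : ℤ); (m : ℤ), (n : ℤ)]).det = 1 ∨
    (!![(p : ℤ), (q : ℤ); (m : ℤ), (n : ℤ)]).det = -1

/-- The bounded gap enclosed by the mutually tangent curves `E[p,m]`, `E[q,n]` and the `x`-axis:
the triangle spanned by the three points of tangency, minus the interiors of the two curves
(these interiors are convex, so two sides of the triangle are chords of the closed regions, and the
third side lies on the axis). -/
def gap (p m q n : ℕ) : Set (ℝ × ℝ) :=
  convexHull ℝ {axisPoint p m, axisPoint q n, tangencyPoint p m q n} \ (inside p m ∪ inside q n)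

/-! The Apollonian depth. -/

/-- One step of the process: a greatest entry of `(a,b,c)` is replaced by
`a + b + c - 2√(ab+bc+ca)`. The entry replaced in case of a tie matters only up to a permutation
of the triple. -/
noncomputable def apStep (T : ℝ × ℝ × ℝ) : ℝ × ℝ × ℝ :=
  let a := T.1
  let b := T.2.1
  let c := T.2.2
  let s := a + b + c - 2 * Real.sqrt (a * b + b * c + c * a)
  if b ≤ a ∧ c ≤ a then (s, b, c) else if c ≤ b then (a, s, c) else (a, b, s)

/-- Some entry is zero or negative. -/
def Stops (T : ℝ × ℝ × ℝ) : Prop := T.1 ≤ 0 ∨ T.2.1 ≤ 0 ∨ T.2.2 ≤ 0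

/-- The Apollonian depth: the number of steps to the first occurrence of an entry `≤ 0`
(`⊤` if there is none). -/
noncomputable def depth (T : ℝ × ℝ × ℝ) : ℕ∞ :=
  ⨅ (n : ℕ) (_ : Stops (apStep^[n] T)), (n : ℕ∞)

/-- The reduced depth function `δ(x,y) = δ(1,x,y)`. -/
noncomputable def delta (z : ℝ × ℝ) : ℕ∞ := depth (1, z.1, z.2)

/-- The unit square, the moduli space of nonnegative triples with greatest entry `1`. -/
def square : Set (ℝ × ℝ) := {z | 0 ≤ z.1 ∧ z.1 ≤ 1 ∧ 0 ≤ z.2 ∧ z.2 ≤ 1}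

def levelSet (k : ℕ) : Set (ℝ × ℝ) := {z | z ∈ square ∧ delta z = (k : ℕ∞)}

/-- `P` is a plateau of value `k`: a connected component of the level set `{δ = k}` in the unit
square. -/
def IsPlateau (k : ℕ) (P : Set (ℝ × ℝ)) : Prop :=
  ∃ z ∈ levelSet k, P = connectedComponentIn (levelSet k) z

/-- `P` coincides, up to boundary points, with the part in the unit square of the region bounded by
`E[p,m]`. (Plateaus are in general neither open nor closed.) -/
def Coincides (P : Set (ℝ × ℝ)) (p m : ℕ) : Prop :=
  inside p m ∩ square ⊆ P ∧ P ⊆ region p m ∩ square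

/-! The Stern–Brocot array. -/

/-- Insert between any two neighbours their vector sum. -/
def sbNext : List (ℕ × ℕ) → List (ℕ × ℕ)
  | u :: v :: l => u :: (u.1 + v.1, u.2 + v.2) :: sbNext (v :: l)
  | l => l

/-- The rows of the Stern–Brocot array, from row `0`, which is `[1,0], [0,1]`. -/
def sbArray : ℕ → List (ℕ × ℕ)
  | 0 => [(1, 0), (0, 1)]
  | k + 1 => sbNext (sbArray k)

/-- `v` stands in row `k` of the Stern–Brocot tree (root `(1,1)` in row `1`): row `k` of the array
is the first one that contains `v`. -/
def IsSBRow (k : ℕ) (v : ℕ × ℕ) : Prop := v ∈ sbArray k ∧ ∀ j < k, v ∉ sbArray j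

/-! The binary quadratic form attached to a point of the plane. -/

/-! Where `disc` ≥ 0, attach to z = (x,y) the form f = `binForm z`, of determinant y², with pairing
B. Since f(1,0) = 1+y and f(0,1) = x+y, the triple (1,x,y) is (f(u)−y, f(v)−y, y) for the standard
basis u, v. For vectors u, v of determinant 1 with B(u,v) ≤ 0, the identity f(u)f(v) = B² + y² shows
that −B is the root in the Apollonian step, so the new entry is f(u+v)−y. While y is not the entry
replaced, the process is a walk down the Stern–Brocot array. For p ≥ 1, the equation of E[p,m]
factors so that the interior becomes f(p,m) < y (`form_mul_sq`, `conjugate_pos`).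

Everything then rests on f(u)f(v) ≥ det(u,v)² y². Two independent integral vectors cannot both have
f < y, so interiors are disjoint. If f(u) = f(v) = y with determinant ±1, then B = 0, and this
determines z: it is the point of tangency.

For plateaus, smallness of f at the target (p,m) dictates every choice along the path to it, by the
subtractive Euclidean algorithm (`IsTrack.exists_target`), and these choices are open conditions.
Hence some open set contains the region off the axis, and on it a first stop at step k means f(p,m)
≤ y; connectedness then confines the plateau to the region. Conversely, at a point close enough to
the axis the first k−1 steps leave y alone (`exists_pair_of_low`), so a stop at step k means f(u+v)
≤ y for neighbours u, v of row k−1. -/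

/-- The discriminant `ab + bc + ca` of the triple `(1,x,y)`. -/
def disc (z : ℝ × ℝ) : ℝ := z.1 * z.2 + z.1 + z.2

/-- The binary quadratic form of determinant `y²` whose values minus `y` are the entries that the
Apollonian process produces from `(1,x,y)`. -/
noncomputable def binForm (z : ℝ × ℝ) (a b : ℝ) : ℝ :=
  a ^ 2 * (1 + z.2) - 2 * a * b * √(disc z) + b ^ 2 * (z.1 + z.2)

/-- The symmetric bilinear form of `binForm`. -/
noncomputable def binPair (z : ℝ × ℝ) (a b c d : ℝ) : ℝ :=
  a * c * (1 + z.2) - (a * d + b * c) * √(disc z) + b * d * (z.1 + z.2)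

/-- A Gram determinant is the squared determinant of the two vectors times the determinant y² of the
form. The hypothesis on `disc` lets the root square back. -/
lemma binForm_mul {z : ℝ × ℝ} (hS : 0 ≤ disc z) (a b c d : ℝ) :
    binForm z a b * binForm z c d = binPair z a b c d ^ 2 + (a * d - b * c) ^ 2 * z.2 ^ 2 := by
  have h := Real.sq_sqrt hS
  simp only [binForm, binPair]
  generalize √(disc z) = s at *
  simp only [disc] at h
  linear_combination (-(a * d - b * c) ^ 2) * h

lemma binForm_nonneg {z : ℝ × ℝ} (hS : 0 ≤ disc z) (hy : 0 ≤ z.2) (a b : ℝ) :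
    0 ≤ binForm z a b := by
  have h := Real.sq_sqrt hS
  have h1 : (1 + z.2) * binForm z a b = ((1 + z.2) * a - √(disc z) * b) ^ 2 + b ^ 2 * z.2 ^ 2 := by
    simp only [binForm]
    generalize √(disc z) = s at *
    simp only [disc] at h
    linear_combination (-b ^ 2) * h
  have h2 : 0 < 1 + z.2 := by linarith
  by_contra! h3
  nlinarith [mul_pos_of_neg_of_neg h3 (neg_neg_of_pos h2), sq_nonneg ((1 + z.2) * a - √(disc z) * b),
    mul_nonneg (sq_nonneg b) (sq_nonneg z.2)]

lemma binForm_add (z : ℝ × ℝ) (a b c d : ℝ) :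
    binForm z (a + c) (b + d) = binForm z a b + binForm z c d + 2 * binPair z a b c d := by
  simp only [binForm, binPair]; ring

lemma binForm_comb (z : ℝ × ℝ) (i j a b c d : ℝ) :
    binForm z (i * a + j * c) (i * b + j * d) =
      i ^ 2 * binForm z a b + 2 * i * j * binPair z a b c d + j ^ 2 * binForm z c d := by
  simp only [binForm, binPair]; ring

lemma binForm_mul_ge {z : ℝ × ℝ} (hS : 0 ≤ disc z) {a b c d : ℝ} {r : ℝ}
    (hdet : r ≤ (a * d - b * c) ^ 2) : r * z.2 ^ 2 ≤ binForm z a b * binForm z c d := by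
  rw [binForm_mul hS]
  nlinarith [sq_nonneg (binPair z a b c d), mul_le_mul_of_nonneg_right hdet (sq_nonneg z.2)]

lemma le_binForm {z : ℝ × ℝ} (hS : 0 ≤ disc z) (hy : 0 ≤ z.2) {a b c d : ℝ}
    (h : binForm z a b ≤ z.2) (hdet : 1 ≤ (a * d - b * c) ^ 2) : z.2 ≤ binForm z c d := by
  by_contra! h1
  have h2 := binForm_mul_ge hS hdet
  have h3 := binForm_nonneg hS hy a b
  have h4 := binForm_nonneg hS hy c d
  nlinarith

lemma lt_binForm {z : ℝ × ℝ} (hS : 0 ≤ disc z) (hy : 0 < z.2) {a b c d : ℝ}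
    (h : binForm z a b < z.2) (hdet : 1 ≤ (a * d - b * c) ^ 2) : z.2 < binForm z c d := by
  by_contra! h1
  have h2 := binForm_mul_ge hS hdet
  have h3 := binForm_nonneg hS hy.le a b
  have h4 := binForm_nonneg hS hy.le c d
  nlinarith

lemma two_mul_lt_binForm {z : ℝ × ℝ} (hS : 0 ≤ disc z) (hy : 0 < z.2) {a b c d : ℝ}
    (h : binForm z a b ≤ z.2) (hdet : 4 ≤ (a * d - b * c) ^ 2) : 2 * z.2 < binForm z c d := by
  by_contra! h1
  have h2 := binForm_mul_ge hS hdet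
  have h3 := binForm_nonneg hS hy.le a b
  have h4 := binForm_nonneg hS hy.le c d
  nlinarith

lemma two_mul_le_binForm_add {z : ℝ × ℝ} (hS : 0 ≤ disc z) (hy : 0 ≤ z.2) {a b c d : ℝ}
    (hdet : 1 ≤ (a * d - b * c) ^ 2) : 2 * z.2 ≤ binForm z a b + binForm z c d := by
  have h2 := binForm_mul_ge hS hdet
  have h3 := binForm_nonneg hS hy a b
  have h4 := binForm_nonneg hS hy c d
  nlinarith [sq_nonneg (binForm z a b - binForm z c d)]

/-- With a nonnegative pairing, every combination with coefficients ≥ 1 would have value at least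
f(u) + f(v) ≥ 2y. -/
lemma binPair_neg {z : ℝ × ℝ} (hS : 0 ≤ disc z) (hy : 0 < z.2) {i j a b c d : ℝ}
    (hdet : 1 ≤ (a * d - b * c) ^ 2) (hi : 1 ≤ i) (hj : 1 ≤ j)
    (h : binForm z (i * a + j * c) (i * b + j * d) ≤ z.2) : binPair z a b c d < 0 := by
  by_contra! hB
  rw [binForm_comb] at h
  have h1 := two_mul_le_binForm_add hS hy.le hdet
  have h3 := binForm_nonneg hS hy.le a b
  have h4 := binForm_nonneg hS hy.le c d
  have h5 : binForm z a b ≤ i ^ 2 * binForm z a b := le_mul_of_one_le_left h3 (by nlinarith)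
  have h6 : binForm z c d ≤ j ^ 2 * binForm z c d := le_mul_of_one_le_left h4 (by nlinarith)
  have h7 : 0 ≤ 2 * i * j * binPair z a b c d := by positivity
  linarith

/-- A vector with larger coefficient on the first basis vector on which the form is small forces
the first basis vector to be the shorter one. -/
lemma binForm_lt_of_small {z : ℝ × ℝ} (hS : 0 ≤ disc z) (hy : 0 < z.2) {i j a b c d : ℝ}
    (hdet : 1 ≤ (a * d - b * c) ^ 2) (hij : j + 1 ≤ i) (hj : 1 ≤ j)
    (h : binForm z (i * a + j * c) (i * b + j * d) ≤ z.2) : binForm z a b < binForm z c d := by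
  by_contra! h1
  -- If the first basis vector were not shorter, swapping the coefficients would not increase the
  -- value. Two vectors of determinant ±(i²−j²) times the old one would then both have value ≤ y,
  -- which the product inequality forbids.
  have h2 : binForm z (j * a + i * c) (j * b + i * d) ≤
      binForm z (i * a + j * c) (i * b + j * d) := by
    rw [binForm_comb, binForm_comb]
    nlinarith [mul_nonneg (sub_nonneg.2 h1) (show 0 ≤ i ^ 2 - j ^ 2 by nlinarith)]
  have h3 : 4 ≤ ((i * a + j * c) * (j * b + i * d) - (i * b + j * d) * (j * a + i * c)) ^ 2 := by
    have h4 : ((i * a + j * c) * (j * b + i * d) - (i * b + j * d) * (j * a + i * c)) ^ 2 =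
      (i ^ 2 - j ^ 2) ^ 2 * (a * d - b * c) ^ 2 := by ring
    have h5 : 2 ≤ i ^ 2 - j ^ 2 := by nlinarith
    rw [h4]; nlinarith
  have := two_mul_lt_binForm hS hy h h3
  linarith

/-! The sign of `form`. -/

/-- Completing the square with a remainder divisible by y exhibits the contact with the axis, the
height bound 1/(m²−1) for m ≥ 2, and the degeneration to a parabola at m = 1. -/
lemma form_eq {p m : ℕ} (hp : p ≠ 0) (hm : m ≠ 0) (z : ℝ × ℝ) :
    form p m z = ((m : ℝ) / p * z.1 + ((m : ℝ) ^ 2 - (p : ℝ) ^ 2 - 1) / (p * m) * z.2 - p / m) ^ 2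
      + 4 * z.2 / (m : ℝ) ^ 2 * (((m : ℝ) ^ 2 - 1) * z.2 - 1) := by
  have : (p : ℝ) ≠ 0 := by exact_mod_cast hp
  have : (m : ℝ) ≠ 0 := by exact_mod_cast hm
  simp only [form]; field_simp; ring

lemma form_eq_disc {p m : ℕ} (hp : p ≠ 0) (hm : m ≠ 0) (z : ℝ × ℝ) :
    form p m z = ((m : ℝ) / p * z.1 + ((p : ℝ) ^ 2 + (m : ℝ) ^ 2 - 1) / (p * m) * z.2 + p / m) ^ 2
      - 4 * disc z := by
  have : (p : ℝ) ≠ 0 := by exact_mod_cast hp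
  have : (m : ℝ) ≠ 0 := by exact_mod_cast hm
  simp only [form, disc]; field_simp; ring

/-- By `form_eq_disc` the equation is a difference of squares L² − (2√disc)². After scaling by pm
the two factors are f(p,m) − y and f(p,−m) − y. -/
lemma form_mul_sq {p m : ℕ} (hp : p ≠ 0) (hm : m ≠ 0) {z : ℝ × ℝ} (hS : 0 ≤ disc z) :
    form p m z * ((p : ℝ) * m) ^ 2 =
      (binForm z p m - z.2) * (binForm z p (-m) - z.2) := by
  have hp' : (p : ℝ) ≠ 0 := by exact_mod_cast hp
  have hm' : (m : ℝ) ≠ 0 := by exact_mod_cast hm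
  have h := Real.sq_sqrt hS
  have h1 : form p m z * ((p : ℝ) * m) ^ 2 =
      ((m : ℝ) ^ 2 * z.1 + ((p : ℝ) ^ 2 + (m : ℝ) ^ 2 - 1) * z.2 + (p : ℝ) ^ 2) ^ 2
        - 4 * ((p : ℝ) * m) ^ 2 * disc z := by
    rw [form_eq_disc hp hm]; field_simp
  rw [h1]
  simp only [binForm]
  linear_combination (4 * ((p : ℝ) * m) ^ 2) * h

lemma disc_nonneg_of_form_nonpos {p m : ℕ} (hp : p ≠ 0) (hm : m ≠ 0) {z : ℝ × ℝ}
    (h : form p m z ≤ 0) : 0 ≤ disc z := by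
  rw [form_eq_disc hp hm] at h
  nlinarith [sq_nonneg ((m : ℝ) / p * z.1 + ((p : ℝ) ^ 2 + (m : ℝ) ^ 2 - 1) / (p * m) * z.2 + p / m)]

lemma bounds_of_form_nonpos {p m : ℕ} (hp : p ≠ 0) (hm : m ≠ 0) {z : ℝ × ℝ}
    (h : form p m z ≤ 0) : 0 ≤ z.2 ∧ ((m : ℝ) ^ 2 - 1) * z.2 ≤ 1 := by
  rw [form_eq hp hm] at h
  have hm1 : (1 : ℝ) ≤ m := by exact_mod_cast Nat.one_le_iff_ne_zero.2 hm
  have h0 : 4 * z.2 / (m : ℝ) ^ 2 * (((m : ℝ) ^ 2 - 1) * z.2 - 1) ≤ 0 := by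
    have := sq_nonneg
      ((m : ℝ) / p * z.1 + ((m : ℝ) ^ 2 - (p : ℝ) ^ 2 - 1) / (p * m) * z.2 - p / m)
    linarith
  have h1 : z.2 * (((m : ℝ) ^ 2 - 1) * z.2 - 1) ≤ 0 := by
    have h2 : 4 * z.2 / (m : ℝ) ^ 2 * (((m : ℝ) ^ 2 - 1) * z.2 - 1) =
      4 / (m : ℝ) ^ 2 * (z.2 * (((m : ℝ) ^ 2 - 1) * z.2 - 1)) := by ring
    rw [h2] at h0
    exact nonpos_of_mul_nonpos_right h0 (by positivity)
  have hy : 0 ≤ z.2 := by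
    by_contra! hy
    nlinarith [mul_nonneg (show (0 : ℝ) ≤ (m : ℝ) ^ 2 - 1 by nlinarith) (sq_nonneg z.2)]
  refine ⟨hy, ?_⟩
  rcases hy.eq_or_lt with hy | hy
  · rw [← hy]; norm_num
  · have := nonpos_of_mul_nonpos_right h1 hy
    linarith

lemma pos_of_form_neg {p m : ℕ} (hp : p ≠ 0) (hm : m ≠ 0) {z : ℝ × ℝ}
    (h : form p m z < 0) : 0 < z.2 := by
  refine (bounds_of_form_nonpos hp hm h.le).1.lt_of_ne fun hy => ?_
  rw [form_eq hp hm, ← hy] at h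
  simp only [mul_zero, zero_div, zero_mul, add_zero] at h
  exact absurd h (not_lt.2 (sq_nonneg _))

lemma conjugate_pos {p : ℕ} (m : ℕ) (hp : p ≠ 0) {z : ℝ × ℝ} (hS : 0 ≤ disc z)
    (hy : 0 ≤ z.2) : 0 < binForm z p (-m) - z.2 := by
  have hp1 : (1 : ℝ) ≤ p := by exact_mod_cast Nat.one_le_iff_ne_zero.2 hp
  -- A negative x + y with y ≥ 0 would make x negative and xy ≤ 0, hence `disc` negative.
  have hxy : 0 ≤ z.1 + z.2 := by
    by_contra! h
    simp only [disc] at hS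
    nlinarith
  have h1 : 0 ≤ (p : ℝ) * m * √(disc z) := by positivity
  have h2 : 0 ≤ (m : ℝ) ^ 2 * (z.1 + z.2) := by positivity
  simp only [binForm]
  nlinarith [mul_nonneg (show (0 : ℝ) ≤ (p : ℝ) ^ 2 - 1 by nlinarith) (show 0 ≤ 1 + z.2 by linarith)]

lemma form_neg_iff {p m : ℕ} (hp : p ≠ 0) (hm : m ≠ 0) {z : ℝ × ℝ} (hS : 0 ≤ disc z)
    (hy : 0 ≤ z.2) : form p m z < 0 ↔ binForm z p m < z.2 := by
  have h := form_mul_sq hp hm hS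
  have h1 := conjugate_pos m hp hS hy
  have h2 : 0 < ((p : ℝ) * m) ^ 2 := by positivity
  rw [← sub_neg (a := binForm z p m)]
  constructor <;> intro h3 <;> by_contra! h4 <;> nlinarith [mul_nonneg h4 h1.le, mul_nonneg h4 h2.le, mul_neg_of_neg_of_pos h3 h1, mul_neg_of_neg_of_pos h3 h2]

lemma form_eq_zero_iff {p m : ℕ} (hp : p ≠ 0) (hm : m ≠ 0) {z : ℝ × ℝ} (hS : 0 ≤ disc z)
    (hy : 0 ≤ z.2) : form p m z = 0 ↔ binForm z p m = z.2 := by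
  have h := form_mul_sq hp hm hS
  have h1 := conjugate_pos m hp hS hy
  have h2 : 0 < ((p : ℝ) * m) ^ 2 := by positivity
  rw [← sub_eq_zero (a := binForm z p m)]
  constructor <;> intro h3
  · rw [h3, zero_mul] at h
    exact (mul_eq_zero.1 h.symm).resolve_right h1.ne'
  · rw [h3, zero_mul] at h
    exact (mul_eq_zero.1 h).resolve_right h2.ne'

lemma form_nonpos_iff {p m : ℕ} (hp : p ≠ 0) (hm : m ≠ 0) {z : ℝ × ℝ} (hS : 0 ≤ disc z)
    (hy : 0 ≤ z.2) : form p m z ≤ 0 ↔ binForm z p m ≤ z.2 := by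
  rw [le_iff_lt_or_eq, le_iff_lt_or_eq, form_neg_iff hp hm hS hy, form_eq_zero_iff hp hm hS hy]

lemma mem_region_iff {p m : ℕ} (hp : p ≠ 0) {z : ℝ × ℝ} : z ∈ region p m ↔ form p m z ≤ 0 := by
  simp only [region, E, inside, Set.mem_union, Set.mem_ofPred_eq, hp, false_and, false_or, ne_eq,
    not_false_eq_true, true_and]
  rw [le_iff_lt_or_eq, or_comm]

lemma mem_inside_iff {p m : ℕ} (hp : p ≠ 0) {z : ℝ × ℝ} : z ∈ inside p m ↔ form p m z < 0 := by
  simp [inside, hp]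

lemma mem_E_iff {p m : ℕ} (hp : p ≠ 0) {z : ℝ × ℝ} : z ∈ E p m ↔ form p m z = 0 := by
  simp [E, hp]

lemma Reduced.snd_ne_zero {p m : ℕ} (h : Reduced p m) : m ≠ 0 := by
  rintro rfl
  have := h.1
  have h2 := h.2
  simp_all [Nat.le_zero.1 h2]

lemma Reduced.eq_one_of_eq_zero {p m : ℕ} (h : Reduced p m) (hp : p = 0) : m = 1 := by
  subst hp
  simpa using h.1

/-- On the half plane where the form is defined, `E[p,m]` is the locus `binForm = y`, also for
`p = 0`. -/
lemma Reduced.mem_E_iff {p m : ℕ} (h : Reduced p m) {z : ℝ × ℝ} (hS : 0 ≤ disc z) (hy : 0 ≤ z.2) :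
    z ∈ E p m ↔ binForm z p m = z.2 := by
  by_cases hp : p = 0
  · have hm := h.eq_one_of_eq_zero hp
    subst hp hm
    simp [E, binForm]
  · rw [_root_.mem_E_iff hp, form_eq_zero_iff hp h.snd_ne_zero hS hy]

lemma binForm_le_of_mem_region {p m : ℕ} (hp : p ≠ 0) (hm : m ≠ 0) {z : ℝ × ℝ}
    (hz : z ∈ region p m) : 0 ≤ disc z ∧ 0 ≤ z.2 ∧ binForm z p m ≤ z.2 := by
  rw [mem_region_iff hp] at hz
  have hS := disc_nonneg_of_form_nonpos hp hm hz
  have hy := (bounds_of_form_nonpos hp hm hz).1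
  exact ⟨hS, hy, (form_nonpos_iff hp hm hS hy).1 hz⟩

lemma binForm_lt_of_mem_inside {p m : ℕ} (hm : m ≠ 0) {z : ℝ × ℝ}
    (hz : z ∈ inside p m) : 0 ≤ disc z ∧ 0 < z.2 ∧ binForm z p m < z.2 := by
  obtain ⟨hp, hz⟩ := hz
  have hS := disc_nonneg_of_form_nonpos hp hm hz.le
  have hy := pos_of_form_neg hp hm hz
  exact ⟨hS, hy, (form_neg_iff hp hm hS hy.le).1 hz⟩

/-! Determinants of integral vectors. -/

lemma one_le_det_sq {p m q n : ℕ} (h : p * n ≠ m * q) :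
    (1 : ℝ) ≤ ((p : ℝ) * n - m * q) ^ 2 := by
  have h1 : ((p : ℤ) * n - m * q) ≠ 0 := sub_ne_zero.2 (by exact_mod_cast h)
  have h2 : (1 : ℤ) ≤ ((p : ℤ) * n - m * q) ^ 2 := by
    have := sq_pos_of_ne_zero h1
    lia
  exact_mod_cast h2

lemma Reduced.cross_ne {p m q n : ℕ} (h : Reduced p m) (h' : Reduced q n)
    (hne : (p, m) ≠ (q, n)) : p * n ≠ m * q := by
  intro he
  apply hne
  have h1 : p ∣ q := h.1.dvd_of_dvd_mul_left ⟨n, by lia⟩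
  have h2 : q ∣ p := h'.1.dvd_of_dvd_mul_right ⟨m, by lia⟩
  have hpq := Nat.dvd_antisymm h1 h2
  have h3 : m ∣ n := h.1.symm.dvd_of_dvd_mul_left ⟨q, by lia⟩
  have h4 : n ∣ m := h'.1.symm.dvd_of_dvd_mul_right ⟨p, by lia⟩
  rw [hpq, Nat.dvd_antisymm h3 h4]

theorem disjoint_inside {p m q n : ℕ} (h : Reduced p m) (h' : Reduced q n)
    (hne : (p, m) ≠ (q, n)) : Disjoint (inside p m) (inside q n) := by
  rw [Set.disjoint_left]
  intro z hz hz'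
  obtain ⟨hS, hy, h1⟩ := binForm_lt_of_mem_inside h.snd_ne_zero hz
  obtain ⟨-, -, h2⟩ := binForm_lt_of_mem_inside h'.snd_ne_zero hz'
  have := lt_binForm hS hy h1 (one_le_det_sq (h.cross_ne h' hne))
  linarith

lemma DetOne.cases {p m q n : ℕ} (h : DetOne p m q n) :
    p * n = m * q + 1 ∨ m * q = p * n + 1 := by
  simp only [DetOne, Matrix.det_fin_two_of] at h
  rcases h with h | h
  · left; zify; linarith
  · right; zify; linarith

/-- The determinant as a real sign. -/
lemma DetOne.exists_sign {p m q n : ℕ} (h : DetOne p m q n) :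
    ∃ e : ℝ, e ^ 2 = 1 ∧ (p : ℝ) * n - m * q = e := by
  rcases h.cases with h | h
  · refine ⟨1, by norm_num, ?_⟩
    have : (p : ℝ) * n = m * q + 1 := by exact_mod_cast h
    linarith
  · refine ⟨-1, by norm_num, ?_⟩
    have : (m : ℝ) * q = p * n + 1 := by exact_mod_cast h
    linarith

lemma DetOne.symm {p m q n : ℕ} (h : DetOne p m q n) : DetOne q n p m := by
  simp only [DetOne, Matrix.det_fin_two_of] at *
  rcases h with h | h
  · right; linarith
  · left; linarith

lemma DetOne.add_left {p m q n : ℕ} (h : DetOne p m q n) : DetOne (p + q) (m + n) p m := by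
  simp only [DetOne, Matrix.det_fin_two_of, Nat.cast_add] at *
  rcases h with h | h
  · right; linarith
  · left; linarith

lemma DetOne.add_right {p m q n : ℕ} (h : DetOne p m q n) : DetOne (p + q) (m + n) q n := by
  simp only [DetOne, Matrix.det_fin_two_of, Nat.cast_add] at *
  rcases h with h | h
  · left; linarith
  · right; linarith

lemma coprime_of_cross {p m q n : ℕ} (h : p * n = m * q + 1 ∨ m * q = p * n + 1) :
    Nat.Coprime p m := by
  apply Nat.dvd_one.1
  have h1 : Nat.gcd p m ∣ p * n := (Nat.gcd_dvd_left p m).mul_right n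
  have h2 : Nat.gcd p m ∣ m * q := (Nat.gcd_dvd_right p m).mul_right q
  rcases h with h | h
  · exact (Nat.dvd_add_right h2).1 (h ▸ h1)
  · exact (Nat.dvd_add_right h1).1 (h ▸ h2)

lemma DetOne.reduced_add {p m q n : ℕ} (h : Reduced p m) (h' : Reduced q n)
    (hd : DetOne p m q n) : Reduced (p + q) (m + n) :=
  ⟨coprime_of_cross hd.add_left.cases, add_le_add h.2 h'.2⟩

lemma DetOne.add_ne_zero {p m q n : ℕ} (hd : DetOne p m q n) : p + q ≠ 0 := by
  intro h
  obtain ⟨rfl, rfl⟩ : p = 0 ∧ q = 0 := by lia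
  simpa using hd.cases

/-! Conics and affine maps. -/

/-- The affine map `(x,y) ↦ (αx + βy + γ, κy + μ)`. -/
noncomputable def triangularAffine (α β γ κ μ : ℝ) (hα : α ≠ 0) (hκ : κ ≠ 0) :
    (ℝ × ℝ) ≃ᵃ[ℝ] (ℝ × ℝ) where
  toFun w := (α * w.1 + β * w.2 + γ, κ * w.2 + μ)
  invFun w := ((w.1 - γ - β * ((w.2 - μ) / κ)) / α, (w.2 - μ) / κ)
  left_inv w := by ext <;> simp <;> field_simp <;> ring
  right_inv w := by ext <;> simp <;> field_simp <;> ring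
  linear :=
    { toFun := fun w => (α * w.1 + β * w.2, κ * w.2)
      map_add' := fun v w => by ext <;> simp <;> ring
      map_smul' := fun c w => by ext <;> simp <;> ring
      invFun := fun w => ((w.1 - β * (w.2 / κ)) / α, w.2 / κ)
      left_inv := fun w => by ext <;> simp <;> field_simp <;> ring
      right_inv := fun w => by ext <;> simp <;> field_simp <;> ring }
  map_vadd' v w := by ext <;> simp <;> ring

@[simp] lemma triangularAffine_apply (α β γ κ μ : ℝ) (hα : α ≠ 0) (hκ : κ ≠ 0) (w : ℝ × ℝ) :
    triangularAffine α β γ κ μ hα hκ w = (α * w.1 + β * w.2 + γ, κ * w.2 + μ) := rfl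

lemma AffineEquiv.image_eq {φ : (ℝ × ℝ) ≃ᵃ[ℝ] (ℝ × ℝ)} {S C : Set (ℝ × ℝ)}
    (h : ∀ w, φ w ∈ C ↔ w ∈ S) : φ '' S = C := by
  have : S = φ ⁻¹' C := by ext w; exact (h w).symm
  rw [this, Set.image_preimage_eq _ φ.surjective]

theorem isEllipse_E {p m : ℕ} (hp : 1 ≤ p) (hm : 2 ≤ m) : IsEllipse (E p m) (inside p m) := by
  have hp0 : p ≠ 0 := by lia
  have hm0 : m ≠ 0 := by lia
  have hp' : (p : ℝ) ≠ 0 := by exact_mod_cast hp0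
  have hm' : (m : ℝ) ≠ 0 := by exact_mod_cast hm0
  have hm2 : (2 : ℝ) ≤ m := by exact_mod_cast hm
  have hD : (0 : ℝ) < (m : ℝ) ^ 2 - 1 := by nlinarith
  set D : ℝ := (m : ℝ) ^ 2 - 1 with hDdef
  have hr : 0 < √D := Real.sqrt_pos.2 hD
  have hr2 : √D ^ 2 = D := Real.sq_sqrt hD.le
  -- The second coordinate y = (1 + w₂)/(2D) carries [−1,1] onto the height range [0,1/D]; the first
  -- is solved so that the squared linear form in `form_eq` becomes w₁/(m√D).
  let φ := triangularAffine (p / m * (1 / (m * √D)))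
    (-(p / m * ((D - (p : ℝ) ^ 2) / (p * m) * (1 / (2 * D)))))
    (p / m * (p / m - (D - (p : ℝ) ^ 2) / (p * m) * (1 / (2 * D)))) (1 / (2 * D)) (1 / (2 * D))
    (by positivity) (by positivity)
  have key : ∀ w, form p m (φ w) = (w.1 ^ 2 + w.2 ^ 2 - 1) * (1 / ((m : ℝ) ^ 2 * D)) := by
    intro w
    rw [form_eq hp0 hm0]
    have h1 : (m : ℝ) / p * (φ w).1 + ((m : ℝ) ^ 2 - (p : ℝ) ^ 2 - 1) / (p * m) * (φ w).2 - p / m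
        = w.1 * (1 / (m * √D)) := by
      have : (m : ℝ) ^ 2 - (p : ℝ) ^ 2 - 1 = D - (p : ℝ) ^ 2 := by rw [hDdef]; ring
      rw [this]
      simp only [φ, triangularAffine_apply]
      field_simp
      ring
    have h2 : (w.1 * (1 / (m * √D))) ^ 2 = w.1 ^ 2 * (1 / ((m : ℝ) ^ 2 * D)) := by
      rw [mul_pow, div_pow, mul_pow, hr2]; ring
    rw [h1, h2, ← hDdef]
    simp only [φ, triangularAffine_apply]
    field_simp
    ring
  have hk : (0 : ℝ) < 1 / ((m : ℝ) ^ 2 * D) := by positivity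
  refine ⟨φ, AffineEquiv.image_eq fun w => ?_, AffineEquiv.image_eq fun w => ?_⟩
  · rw [mem_E_iff hp0, key, mul_eq_zero, or_iff_left hk.ne', sub_eq_zero]; rfl
  · rw [mem_inside_iff hp0, key, mul_neg_iff]
    simp only [hk, hk.not_gt, and_false, false_or, and_true, sub_neg]
    rfl

theorem isParabola_E : IsParabola (E 1 1) (inside 1 1) := by
  let φ := triangularAffine 2 1 1 1 0 (by norm_num) (by norm_num)
  have key : ∀ w, form 1 1 (φ w) = 4 * (w.1 ^ 2 - w.2) := by
    intro w
    rw [form_eq one_ne_zero one_ne_zero]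
    simp only [φ, triangularAffine_apply]
    norm_num
    ring
  refine ⟨φ, AffineEquiv.image_eq fun w => ?_, AffineEquiv.image_eq fun w => ?_⟩
  · rw [mem_E_iff one_ne_zero, key, Set.mem_ofPred_eq]
    constructor <;> intro h <;> linarith
  · rw [mem_inside_iff one_ne_zero, key, Set.mem_ofPred_eq]
    constructor <;> intro h <;> linarith

theorem E_inter_xAxis {p m : ℕ} (h : Reduced p m) : E p m ∩ xAxis = {axisPoint p m} := by
  have hm0 := h.snd_ne_zero
  have hm' : (m : ℝ) ≠ 0 := by exact_mod_cast hm0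
  ext z
  simp only [Set.mem_inter_iff, xAxis, Set.mem_ofPred_eq, Set.mem_singleton_iff, axisPoint,
    Prod.ext_iff]
  refine and_congr_left fun hz => ?_
  by_cases hp : p = 0
  · subst hp; simp [E]
  · have hp' : (p : ℝ) ≠ 0 := by exact_mod_cast hp
    rw [mem_E_iff hp, form_eq hp hm0, hz]
    simp only [mul_zero, zero_div, zero_mul, add_zero, ne_eq, OfNat.ofNat_ne_zero,
      not_false_eq_true, pow_eq_zero_iff]
    constructor <;> intro h1
    · field_simp at h1 ⊢; linarith
    · rw [h1]; field_simp; ring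

/-! Tangents. -/

lemma HasTangent.smul {C : Set (ℝ × ℝ)} {P v : ℝ × ℝ} (h : HasTangent C P v) {c : ℝ}
    (hc : c ≠ 0) : HasTangent C P (c • v) := by
  obtain ⟨hv, γ, h0, hC, hd⟩ := h
  refine ⟨smul_ne_zero hc hv, fun t => γ (c * t), by simpa using h0, fun t => hC _, ?_⟩
  have h1 : HasDerivAt (fun t : ℝ => c * t) c 0 := by
    simpa using (hasDerivAt_id (0 : ℝ)).const_mul c
  have h2 : HasDerivAt γ v (c * 0) := by simpa using hd
  exact h2.scomp 0 h1

lemma hasTangent_of_line {C : Set (ℝ × ℝ)} {P v : ℝ × ℝ} (hv : v ≠ 0)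
    (h : ∀ t : ℝ, P + t • v ∈ C) : HasTangent C P v := by
  refine ⟨hv, fun t => P + t • v, by simp, h, ?_⟩
  simpa using ((hasDerivAt_id (0 : ℝ)).smul_const v).const_add P

/-- A conic through `P` has the tangent direction on which the differential of its equation
vanishes; the curve is parametrized by the chords through `P`. -/
lemma hasTangent_of_quadratic {F : ℝ × ℝ → ℝ} {P d e : ℝ × ℝ} {l a b c : ℝ}
    (hF : ∀ s t : ℝ, F (P + (s • d + t • e)) = l * t + (a * s ^ 2 + b * s * t + c * t ^ 2))
    (hd : d ≠ 0) (hl : l ≠ 0) (ha : a ≠ 0) : HasTangent {z | F z = 0} P d := by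
  -- On the chord of slope t, through P + s d + (ts) e, the equation divided by s is linear in s,
  -- with root s = −lt/(a + bt + ct²). The velocity at t = 0 is (−l/a) d.
  have key : HasTangent {z | F z = 0} P ((-l / a) • d) := by
    refine ⟨smul_ne_zero (div_ne_zero (neg_ne_zero.2 hl) ha) hd,
      fun t => P + ((-l * t / (a + b * t + c * t ^ 2)) • d +
        (t * (-l * t / (a + b * t + c * t ^ 2))) • e), by simp, fun t => ?_, ?_⟩
    · show F _ = 0
      rw [hF]
      -- Where the denominator vanishes, division by zero gives s = 0, and the motion sits at P,
      -- still on the curve.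
      by_cases hq : a + b * t + c * t ^ 2 = 0
      · simp [hq]
      · field_simp
        ring
    · have hden : HasDerivAt (fun t : ℝ => a + b * t + c * t ^ 2) (b * 1 + c * (2 * 0)) 0 := by
        simpa using (((hasDerivAt_id (0 : ℝ)).const_mul b).const_add a).fun_add
          ((hasDerivAt_pow 2 (0 : ℝ)).const_mul c)
      have hnum : HasDerivAt (fun t : ℝ => -l * t) (-l) 0 := by
        simpa using (hasDerivAt_id (0 : ℝ)).const_mul (-l)
      have hq : HasDerivAt (fun t : ℝ => -l * t / (a + b * t + c * t ^ 2)) (-l / a) 0 := by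
        refine (hnum.fun_div hden (by simpa using ha)).congr_deriv ?_
        simp only [mul_zero, zero_mul, add_zero, ne_eq, OfNat.ofNat_ne_zero, not_false_eq_true,
          zero_pow, sub_zero]
        field_simp
      have hq2 : HasDerivAt (fun t : ℝ => t * (-l * t / (a + b * t + c * t ^ 2))) 0 0 := by
        exact ((hasDerivAt_id' (0 : ℝ)).fun_mul hq).congr_deriv (by simp)
      have := ((hq.smul_const d).fun_add (hq2.smul_const e)).const_add P
      simpa using this
  have h2 := key.smul (c := (-l / a)⁻¹) (inv_ne_zero (div_ne_zero (neg_ne_zero.2 hl) ha))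
  rwa [inv_smul_smul₀ (div_ne_zero (neg_ne_zero.2 hl) ha)] at h2

lemma E_eq_setOf {p m : ℕ} (hp : p ≠ 0) : E p m = {z | form p m z = 0} := by
  ext z; exact mem_E_iff hp

theorem tangentAt_xAxis {p m : ℕ} (hp : p ≠ 0) (hm : m ≠ 0) :
    TangentAt (E p m) xAxis (axisPoint p m) := by
  have hp' : (p : ℝ) ≠ 0 := by exact_mod_cast hp
  have hm' : (m : ℝ) ≠ 0 := by exact_mod_cast hm
  refine ⟨(1, 0), ?_, hasTangent_of_line (by simp) fun t => by simp [xAxis, axisPoint]⟩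
  rw [E_eq_setOf hp]
  refine hasTangent_of_quadratic (e := (0, 1)) (l := -4 / (m : ℝ) ^ 2) (a := ((m : ℝ) / p) ^ 2)
    (b := 2 * ((m : ℝ) / p) * (((m : ℝ) ^ 2 - (p : ℝ) ^ 2 - 1) / (p * m)))
    (c := (((m : ℝ) ^ 2 - (p : ℝ) ^ 2 - 1) / (p * m)) ^ 2 + 4 * ((m : ℝ) ^ 2 - 1) / (m : ℝ) ^ 2)
    (fun s t => ?_) (by simp) (by simp [hm']) (by simp [hm', hp'])
  rw [form_eq hp hm]
  simp [axisPoint]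
  field_simp
  ring

/-! Neighbours in the Stern–Brocot array. -/

/-- `u, v` are neighbours in row `k`, reached from the first row by repeated insertion. -/
inductive SBPair : ℕ → ℕ × ℕ → ℕ × ℕ → Prop
  | root : SBPair 0 (1, 0) (0, 1)
  | fst {k : ℕ} {u v : ℕ × ℕ} : SBPair k u v → SBPair (k + 1) (u + v) v
  | snd {k : ℕ} {u v : ℕ × ℕ} : SBPair k u v → SBPair (k + 1) u (u + v)

lemma SBPair.det {k : ℕ} {u v : ℕ × ℕ} (h : SBPair k u v) : u.1 * v.2 = u.2 * v.1 + 1 := by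
  induction h with
  | root => rfl
  | fst _ ih => simp only [Prod.fst_add, Prod.snd_add]; linarith
  | snd _ ih => simp only [Prod.fst_add, Prod.snd_add]; linarith

/-- `u` precedes `v`: the fraction of `u` is greater. -/
def Precedes (u v : ℕ × ℕ) : Prop := u.2 * v.1 < u.1 * v.2

lemma Precedes.trans {u v w : ℕ × ℕ} (h : Precedes u v) (h' : Precedes v w) : Precedes u w := by
  simp only [Precedes] at *
  by_contra! hc
  -- The added ones keep the multiplied inequality strict even if v has a zero coordinate.
  have h1 : (u.2 * v.1 + 1) * (v.2 * w.1 + 1) ≤ (u.1 * v.2) * (v.1 * w.2) := Nat.mul_le_mul h h'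
  have h2 : (u.1 * w.2) * (v.1 * v.2) ≤ (u.2 * w.1) * (v.1 * v.2) := Nat.mul_le_mul_right _ hc
  nlinarith [Nat.zero_le (u.2 * v.1), Nat.zero_le (v.2 * w.1)]

instance : IsTrans (ℕ × ℕ) Precedes := ⟨fun _ _ _ => Precedes.trans⟩

lemma Precedes.add {u v : ℕ × ℕ} (h : Precedes u v) : Precedes u (u + v) ∧ Precedes (u + v) v := by
  simp only [Precedes, Prod.fst_add, Prod.snd_add] at *
  constructor <;> linarith

lemma isChain_sbNext : ∀ {l : List (ℕ × ℕ)}, l.IsChain Precedes → (sbNext l).IsChain Precedes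
  | [], _ => by simp [sbNext]
  | [u], _ => by simp [sbNext]
  | [u, v], h => by
    have h1 : Precedes u v := by simpa using h
    simp only [sbNext, List.isChain_cons_cons, List.IsChain.singleton, and_true]
    exact h1.add
  | u :: v :: w :: l, h => by
    have h1 : Precedes u v := (List.isChain_cons_cons.1 h).1
    have h2 := isChain_sbNext (List.isChain_cons_cons.1 h).2
    rw [sbNext] at h2
    rw [sbNext, sbNext]
    exact List.isChain_cons_cons.2 ⟨h1.add.1, List.isChain_cons_cons.2 ⟨h1.add.2, h2⟩⟩

lemma isChain_sbArray (k : ℕ) : (sbArray k).IsChain Precedes := by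
  induction k with
  | zero => simp [sbArray, Precedes]
  | succ k ih => exact isChain_sbNext ih

lemma pairwise_sbArray (k : ℕ) : (sbArray k).Pairwise Precedes :=
  (isChain_sbArray k).pairwise

lemma sbNext_cons (u : ℕ × ℕ) (l : List (ℕ × ℕ)) : ∃ l', sbNext (u :: l) = u :: l' := by
  cases l with
  | nil => exact ⟨[], rfl⟩
  | cons v l => exact ⟨_, rfl⟩

lemma sbNext_append (u v : ℕ × ℕ) (l₂ : List (ℕ × ℕ)) : ∀ l₁ : List (ℕ × ℕ),
    ∃ l₁' l₂', sbNext (l₁ ++ u :: v :: l₂) = l₁' ++ u :: (u + v) :: v :: l₂'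
  | [] => by
    obtain ⟨l', hl'⟩ := sbNext_cons v l₂
    exact ⟨[], l', by simp [sbNext, hl', Prod.add_def]⟩
  | [w] => by
    obtain ⟨l', hl'⟩ := sbNext_cons v l₂
    exact ⟨[w, w + u], l', by simp [sbNext, hl', Prod.add_def]⟩
  | w :: w' :: l₁ => by
    obtain ⟨l₁', l₂', h⟩ := sbNext_append u v l₂ (w' :: l₁)
    exact ⟨w :: (w + w') :: l₁', l₂', by
      simp only [List.cons_append] at h ⊢
      rw [sbNext, h]; rfl⟩

lemma SBPair.exists_append {k : ℕ} {u v : ℕ × ℕ} (h : SBPair k u v) :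
    ∃ l₁ l₂, sbArray k = l₁ ++ u :: v :: l₂ := by
  induction h with
  | root => exact ⟨[], [], rfl⟩
  | @fst k u v _ ih =>
    obtain ⟨l₁, l₂, h⟩ := ih
    obtain ⟨l₁', l₂', h'⟩ := sbNext_append u v l₂ l₁
    exact ⟨l₁' ++ [u], l₂', by rw [sbArray, h, h']; simp⟩
  | @snd k u v _ ih =>
    obtain ⟨l₁, l₂, h⟩ := ih
    obtain ⟨l₁', l₂', h'⟩ := sbNext_append u v l₂ l₁
    exact ⟨l₁', v :: l₂', by rw [sbArray, h, h']⟩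

lemma subset_sbNext : ∀ l : List (ℕ × ℕ), l ⊆ sbNext l
  | [] => by simp
  | [u] => by simp [sbNext]
  | u :: v :: l => by
    have h := subset_sbNext (v :: l)
    intro w hw
    rw [sbNext]
    rcases List.mem_cons.1 hw with rfl | hw
    · simp
    · exact List.mem_cons_of_mem _ (List.mem_cons_of_mem _ (h hw))

lemma sbArray_subset {j k : ℕ} (h : j ≤ k) : sbArray j ⊆ sbArray k := by
  induction k, h using Nat.le_induction with
  | base => exact fun _ => id
  | succ k _ ih => exact fun _ hw => subset_sbNext _ (ih hw)

/-- Row k is strictly ordered by `Precedes` and u, v are adjacent in it, while their mediant lies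
strictly between them, so it cannot occur there. Rows are nested, so it occurs in no earlier row
either. -/
theorem SBPair.isSBRow_add {k : ℕ} {u v : ℕ × ℕ} (h : SBPair k u v) :
    IsSBRow (k + 1) (u + v) := by
  obtain ⟨l₁, l₂, hk⟩ := h.exists_append
  obtain ⟨l₁', l₂', hk'⟩ := sbNext_append u v l₂ l₁
  refine ⟨by rw [sbArray, hk, hk']; simp, fun j hj hmem => ?_⟩
  have hmem := sbArray_subset (Nat.lt_succ_iff.1 hj) hmem
  have hp := pairwise_sbArray k
  have hdet := h.det
  rw [hk] at hmem hp
  rw [List.pairwise_append] at hp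
  obtain ⟨-, hp2, hp3⟩ := hp
  rw [List.pairwise_cons, List.pairwise_cons] at hp2
  simp only [List.mem_append, List.mem_cons] at hmem
  rcases hmem with hw | hw | hw | hw
  · have := hp3 _ hw u (by simp)
    simp only [Precedes, Prod.fst_add, Prod.snd_add] at this
    lia
  · have h1 := congrArg Prod.fst hw
    have h2 := congrArg Prod.snd hw
    simp only [Prod.fst_add, Prod.snd_add, Nat.add_eq_left] at h1 h2
    simp [h1, h2] at hdet
  · have h1 := congrArg Prod.fst hw
    have h2 := congrArg Prod.snd hw
    simp only [Prod.fst_add, Prod.snd_add, Nat.add_eq_right] at h1 h2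
    simp [h1, h2] at hdet
  · have := hp2.2.1 _ hw
    simp only [Precedes, Prod.fst_add, Prod.snd_add] at this
    lia

lemma IsSBRow.unique {j k : ℕ} {v : ℕ × ℕ} (h : IsSBRow j v) (h' : IsSBRow k v) : j = k := by
  rcases lt_trichotomy j k with hlt | heq | hlt
  · exact absurd h.1 (h'.2 j hlt)
  · exact heq
  · exact absurd h'.1 (h.2 k hlt)

/-! Mutually tangent curves. -/

/-- The left side is f at n(p,m) − m(q,n) = (det, 0). Together with the analogous identity for (0,
det), it recovers x and y from values on a basis. -/
lemma binForm_dual_snd (z : ℝ × ℝ) (p m q n : ℝ) :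
    n ^ 2 * binForm z p m - 2 * m * n * binPair z p m q n + m ^ 2 * binForm z q n =
      (p * n - m * q) ^ 2 * (1 + z.2) := by
  simp only [binForm, binPair]; ring

lemma binForm_dual_fst (z : ℝ × ℝ) (p m q n : ℝ) :
    q ^ 2 * binForm z p m - 2 * p * q * binPair z p m q n + p ^ 2 * binForm z q n =
      (p * n - m * q) ^ 2 * (z.1 + z.2) := by
  simp only [binForm, binPair]; ring

lemma Reduced.one_le_snd {p m : ℕ} (h : Reduced p m) : (1 : ℝ) ≤ m := by
  exact_mod_cast Nat.one_le_iff_ne_zero.2 h.snd_ne_zero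

/-- At this point `disc` is a perfect square, so the root in f is rational and explicit. -/
lemma tangencyPoint_mem {p m q n : ℕ} (h : Reduced p m) (h' : Reduced q n)
    (hd : DetOne p m q n) : tangencyPoint p m q n ∈ E p m := by
  obtain ⟨e, he2, he⟩ := hd.exists_sign
  have hm := h.one_le_snd
  have hn := h'.one_le_snd
  have hN : (0 : ℝ) < (m : ℝ) ^ 2 + (n : ℝ) ^ 2 - 1 := by nlinarith
  have hdisc : disc (tangencyPoint p m q n) =
      (((m : ℝ) * p + n * q) / ((m : ℝ) ^ 2 + (n : ℝ) ^ 2 - 1)) ^ 2 := by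
    simp only [disc, tangencyPoint]
    field_simp
    subst he
    linear_combination he2
  have hy : (0 : ℝ) ≤ (tangencyPoint p m q n).2 := by
    simp only [tangencyPoint]; positivity
  rw [h.mem_E_iff (hdisc ▸ sq_nonneg _) hy, binForm, hdisc, Real.sqrt_sq (by positivity)]
  simp only [tangencyPoint]
  field_simp
  subst he
  linear_combination he2

/-- Both values equal y, so the Gram identity forces the pairing to vanish. The dual identities
become 1+y = (m²+n²)y and x+y = (p²+q²)y. -/
theorem E_inter_E {p m q n : ℕ} (h : Reduced p m) (h' : Reduced q n) (hd : DetOne p m q n) :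
    E p m ∩ E q n = {tangencyPoint p m q n} := by
  have hcomm : tangencyPoint q n p m = tangencyPoint p m q n := by
    simp only [tangencyPoint, add_comm]
  refine Set.Subset.antisymm ?_ (Set.singleton_subset_iff.2 ⟨tangencyPoint_mem h h' hd,
    hcomm ▸ tangencyPoint_mem h' h hd.symm⟩)
  rintro z ⟨hz, hz'⟩
  obtain ⟨hS, hy⟩ : 0 ≤ disc z ∧ 0 ≤ z.2 := by
    by_cases hp : p = 0
    · have hq : q ≠ 0 := by
        have := hd.add_ne_zero
        lia
      have := binForm_le_of_mem_region hq h'.snd_ne_zero (Or.inl hz')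
      exact ⟨this.1, this.2.1⟩
    · have := binForm_le_of_mem_region hp h.snd_ne_zero (Or.inl hz)
      exact ⟨this.1, this.2.1⟩
  rw [h.mem_E_iff hS hy] at hz
  rw [h'.mem_E_iff hS hy] at hz'
  obtain ⟨e, he2, he⟩ := hd.exists_sign
  have hmul := binForm_mul hS p m q n
  have h1 := binForm_dual_snd z p m q n
  have h2 := binForm_dual_fst z p m q n
  rw [he, he2] at h1 h2 hmul
  rw [hz, hz'] at h1 h2 hmul
  have hB : binPair z p m q n = 0 := by
    apply pow_eq_zero_iff (two_ne_zero) |>.1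
    linarith
  rw [hB] at h1 h2
  have hm := h.one_le_snd
  have hn := h'.one_le_snd
  have hN : (0 : ℝ) < (m : ℝ) ^ 2 + (n : ℝ) ^ 2 - 1 := by nlinarith
  have hy1 : z.2 = 1 / ((m : ℝ) ^ 2 + (n : ℝ) ^ 2 - 1) := by
    field_simp; linarith
  refine Prod.ext ?_ hy1
  show z.1 = ((p : ℝ) ^ 2 + (q : ℝ) ^ 2 - 1) / ((m : ℝ) ^ 2 + (n : ℝ) ^ 2 - 1)
  rw [div_eq_mul_one_div, ← hy1]
  linarith

lemma form_add {p m : ℕ} (hp : p ≠ 0) (hm : m ≠ 0) (P v : ℝ × ℝ) :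
    form p m (P + v) = form p m P +
      (2 * ((m : ℝ) / p * P.1 + ((m : ℝ) ^ 2 - (p : ℝ) ^ 2 - 1) / (p * m) * P.2 - p / m) *
          ((m : ℝ) / p * v.1 + ((m : ℝ) ^ 2 - (p : ℝ) ^ 2 - 1) / (p * m) * v.2)
        + 4 * v.2 / (m : ℝ) ^ 2 * (2 * ((m : ℝ) ^ 2 - 1) * P.2 - 1)) +
      (((m : ℝ) / p * v.1 + ((m : ℝ) ^ 2 - (p : ℝ) ^ 2 - 1) / (p * m) * v.2) ^ 2
        + 4 * ((m : ℝ) ^ 2 - 1) / (m : ℝ) ^ 2 * v.2 ^ 2) := by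
  rw [form_eq hp hm, form_eq hp hm, Prod.fst_add, Prod.snd_add]
  ring

/-- The direction is written so that exchanging the two curves, which turns e into −e, merely
negates it; one computation thus serves both curves. -/
lemma hasTangent_tangencyPoint {p m q n : ℕ} (h : Reduced p m) (h' : Reduced q n)
    (hd : DetOne p m q n) {e : ℝ} (he2 : e ^ 2 = 1) (he : (p : ℝ) * n - m * q = e) :
    HasTangent (E p m) (tangencyPoint p m q n)
      (e * (p * q - n * m) + m * p - n * q, e * n * m) := by
  have hm := h.one_le_snd
  have hn := h'.one_le_snd
  have he0 : e ≠ 0 := by rintro rfl; norm_num at he2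
  have hN : (0 : ℝ) < (m : ℝ) ^ 2 + (n : ℝ) ^ 2 - 1 := by nlinarith
  have hd2 : e * n * m ≠ 0 := by
    have : (n : ℝ) ≠ 0 := by linarith
    have : (m : ℝ) ≠ 0 := by linarith
    positivity
  have hd0 : (e * (p * q - n * m) + m * p - n * q, e * n * m) ≠ (0 : ℝ × ℝ) :=
    fun h0 => hd2 (congrArg Prod.snd h0)
  by_cases hp : p = 0
  · have hm1 := h.eq_one_of_eq_zero hp
    subst hp hm1
    have hq : q = 1 := by
      rcases hd.cases with h1 | h1 <;> lia
    subst hq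
    refine hasTangent_of_line hd0 fun t => Or.inl ⟨rfl, ?_⟩
    have : e = -1 := by rw [← he]; norm_num
    simp [tangencyPoint, this]
  have hm0 := h.snd_ne_zero
  have hp' : (p : ℝ) ≠ 0 := by exact_mod_cast hp
  have hm' : (m : ℝ) ≠ 0 := by exact_mod_cast hm0
  have hF := (mem_E_iff hp).1 (tangencyPoint_mem h h' hd)
  have hW : (m : ℝ) / p * (tangencyPoint p m q n).1 +
      ((m : ℝ) ^ 2 - (p : ℝ) ^ 2 - 1) / (p * m) * (tangencyPoint p m q n).2 - p / m =
      -2 * e * n / (m * ((m : ℝ) ^ 2 + (n : ℝ) ^ 2 - 1)) := by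
    simp only [tangencyPoint]
    field_simp
    subst he
    linear_combination he2
  set w : ℝ := (m : ℝ) / p * (e * (p * q - n * m) + m * p - n * q) +
    ((m : ℝ) ^ 2 - (p : ℝ) ^ 2 - 1) / (p * m) * (e * n * m) with hw
  have hw' : w = ((m : ℝ) ^ 2 - 1 - (n : ℝ) ^ 2) := by
    rw [hw]
    field_simp
    linear_combination (n - e * p) * he - p * he2
  rw [E_eq_setOf hp]
  refine hasTangent_of_quadratic (e := (1, 0))
    (l := -4 * e * n / (p * ((m : ℝ) ^ 2 + (n : ℝ) ^ 2 - 1)))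
    (a := w ^ 2 + 4 * ((m : ℝ) ^ 2 - 1) / (m : ℝ) ^ 2 * (e * n * m) ^ 2)
    (b := 2 * w * (m / p)) (c := ((m : ℝ) / p) ^ 2) (fun s t => ?_) hd0 ?_ ?_
  · rw [form_add hp hm0, hF, hW]
    have hv1 : (s • (e * (p * q - n * m) + m * p - n * q, e * n * m) + t • ((1, 0) : ℝ × ℝ)).2 =
      s * (e * n * m) := by simp
    have hv2 : (m : ℝ) / p *
        (s • (e * (p * q - n * m) + m * p - n * q, e * n * m) + t • ((1, 0) : ℝ × ℝ)).1 +
        ((m : ℝ) ^ 2 - (p : ℝ) ^ 2 - 1) / (p * m) *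
        (s • (e * (p * q - n * m) + m * p - n * q, e * n * m) + t • ((1, 0) : ℝ × ℝ)).2 =
        s * w + t * (m / p) := by
      rw [hw]; simp; ring
    rw [hv2, hv1]
    -- The vanishing linear term along the chosen direction is the tangency itself.
    have hlin : 2 * (-2 * e * n / (m * ((m : ℝ) ^ 2 + (n : ℝ) ^ 2 - 1))) * w +
        4 * (e * n * m) / (m : ℝ) ^ 2 * (2 * ((m : ℝ) ^ 2 - 1) * (tangencyPoint p m q n).2 - 1)
        = 0 := by
      rw [hw']
      simp only [tangencyPoint]
      field_simp
      ring
    have hl : 2 * (-2 * e * n / (m * ((m : ℝ) ^ 2 + (n : ℝ) ^ 2 - 1))) * (m / p) =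
        -4 * e * n / (p * ((m : ℝ) ^ 2 + (n : ℝ) ^ 2 - 1)) := by
      field_simp
      ring
    linear_combination s * hlin + t * hl
  · have : (n : ℝ) ≠ 0 := by linarith
    exact div_ne_zero (by positivity) (mul_ne_zero hp' hN.ne')
  -- For m = 1 the y² term of the quadratic part disappears, and w = −n² alone must keep it nonzero.
  · rcases Nat.lt_or_ge m 2 with hm2 | hm2
    · have hm1 : m = 1 := by lia
      subst hm1
      have : w = -(n : ℝ) ^ 2 := by rw [hw']; norm_num
      rw [this]
      have : (n : ℝ) ≠ 0 := by linarith
      norm_num [this]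
    · have hm2' : (2 : ℝ) ≤ m := by exact_mod_cast hm2
      have : (0 : ℝ) < (m : ℝ) ^ 2 - 1 := by nlinarith
      positivity

theorem tangentAt_tangencyPoint {p m q n : ℕ} (h : Reduced p m) (h' : Reduced q n)
    (hd : DetOne p m q n) : TangentAt (E p m) (E q n) (tangencyPoint p m q n) := by
  obtain ⟨e, he2, he⟩ := hd.exists_sign
  refine ⟨_, hasTangent_tangencyPoint h h' hd he2 he, ?_⟩
  have h1 := (hasTangent_tangencyPoint h' h hd.symm (e := -e) (by simpa using he2)
    (by rw [← he]; ring)).smul (c := -1) (by norm_num)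
  have hcomm : tangencyPoint q n p m = tangencyPoint p m q n := by
    simp only [tangencyPoint, add_comm]
  rw [hcomm] at h1
  convert h1 using 1
  ext <;> simp <;> ring

/-! The gap between two tangent curves. -/

lemma mem_convexHull_triple {P Q R : ℝ × ℝ} {a b c : ℝ} (ha : 0 ≤ a) (hb : 0 ≤ b) (hc : 0 ≤ c)
    (h : a + b + c = 1) : a • P + b • Q + c • R ∈ convexHull ℝ {P, Q, R} := by
  have := (convex_convexHull ℝ ({P, Q, R} : Set (ℝ × ℝ))).sum_mem (t := Finset.univ)
    (w := ![a, b, c]) (z := ![P, Q, R]) (by intro i _; fin_cases i <;> simpa)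
    (by simpa [Fin.sum_univ_three] using h)
    (by intro i _; apply subset_convexHull; fin_cases i <;> simp)
  simpa [Fin.sum_univ_three] using this

/-- Smallness at the mediant forces f(p,m), f(q,n) ≥ y and B ≤ 0. These signs make the barycentric
coordinates of the point in the triangle nonnegative. -/
theorem region_add_subset_gap {p m q n : ℕ} (h : Reduced p m) (h' : Reduced q n)
    (hd : DetOne p m q n) : region (p + q) (m + n) ⊆ gap p m q n := by
  intro z hz
  have hr := hd.reduced_add h h'
  obtain ⟨hS, hy, hw⟩ := binForm_le_of_mem_region hd.add_ne_zero hr.snd_ne_zero hz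
  obtain ⟨e, he2, he⟩ := hd.exists_sign
  have hm := h.one_le_snd
  have hn := h'.one_le_snd
  push_cast at hw
  have hA : z.2 ≤ binForm z p m := le_binForm hS hy hw <| by
    have : (((p : ℝ) + q) * m - (m + n) * p) ^ 2 = e ^ 2 := by rw [← he]; ring
    rw [this, he2]
  have hD : z.2 ≤ binForm z q n := le_binForm hS hy hw <| by
    have : (((p : ℝ) + q) * n - (m + n) * q) ^ 2 = e ^ 2 := by rw [← he]; ring
    rw [this, he2]
  have hB : binPair z p m q n ≤ 0 := by
    rw [binForm_add] at hw
    linarith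
  refine ⟨?_, ?_⟩
  · have hN : (0 : ℝ) < (m : ℝ) ^ 2 + (n : ℝ) ^ 2 - 1 := by nlinarith
    have hK : (0 : ℝ) < (n : ℝ) * p + q * m := by
      have : (1 : ℝ) ≤ (p : ℝ) + q := by
        exact_mod_cast Nat.one_le_iff_ne_zero.2 hd.add_ne_zero
      have h1 : (p : ℝ) ≤ n * p := le_mul_of_one_le_left (by positivity) hn
      have h2 : (q : ℝ) ≤ q * m := le_mul_of_one_le_right (by positivity) hm
      linarith
    have hl1 : 0 ≤ ((m : ℝ) * q + p * n) * (binForm z p m - z.2) - 2 * p * m * binPair z p m q n := by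
      have h1 := mul_nonneg (show (0 : ℝ) ≤ (m : ℝ) * q + p * n by positivity) (sub_nonneg.2 hA)
      have h2 := mul_nonpos_of_nonneg_of_nonpos (show (0 : ℝ) ≤ 2 * p * m by positivity) hB
      linarith
    have hl2 : 0 ≤ ((m : ℝ) * q + p * n) * (binForm z q n - z.2) - 2 * q * n * binPair z p m q n := by
      have h1 := mul_nonneg (show (0 : ℝ) ≤ (m : ℝ) * q + p * n by positivity) (sub_nonneg.2 hD)
      have h2 := mul_nonpos_of_nonneg_of_nonpos (show (0 : ℝ) ≤ 2 * q * n by positivity) hB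
      linarith
    have e1 : ((m : ℝ) * q + p * n) * (binForm z p m - z.2) - 2 * p * m * binPair z p m q n =
        -e * ((m : ℝ) ^ 2 * (z.1 + z.2) - (p : ℝ) ^ 2 * (1 + z.2)) - (n * p + q * m) * z.2 := by
      rw [← he]; simp only [binForm, binPair]; ring
    have e2 : ((m : ℝ) * q + p * n) * (binForm z q n - z.2) - 2 * q * n * binPair z p m q n =
        e * ((n : ℝ) ^ 2 * (z.1 + z.2) - (q : ℝ) ^ 2 * (1 + z.2)) - (n * p + q * m) * z.2 := by
      rw [← he]; simp only [binForm, binPair]; ring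
    rw [e1] at hl1
    rw [e2] at hl2
    have hsum : (m : ℝ) ^ 2 * (e * ((n : ℝ) ^ 2 * (z.1 + z.2) - (q : ℝ) ^ 2 * (1 + z.2)) -
        (n * p + q * m) * z.2) + (n : ℝ) ^ 2 * (-e * ((m : ℝ) ^ 2 * (z.1 + z.2) -
        (p : ℝ) ^ 2 * (1 + z.2)) - (n * p + q * m) * z.2) =
        (n * p + q * m) * (1 - z.2 * ((m : ℝ) ^ 2 + (n : ℝ) ^ 2 - 1)) := by
      linear_combination (e * (n * p + q * m) * (1 + z.2)) * he +
        ((n * p + q * m) * (1 + z.2)) * he2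
    have hfst : (p : ℝ) ^ 2 * (e * ((n : ℝ) ^ 2 * (z.1 + z.2) - (q : ℝ) ^ 2 * (1 + z.2)) -
        (n * p + q * m) * z.2) + (q : ℝ) ^ 2 * (-e * ((m : ℝ) ^ 2 * (z.1 + z.2) -
        (p : ℝ) ^ 2 * (1 + z.2)) - (n * p + q * m) * z.2) =
        (n * p + q * m) * (z.1 - z.2 * ((p : ℝ) ^ 2 + (q : ℝ) ^ 2 - 1)) := by
      linear_combination (e * (n * p + q * m) * (z.1 + z.2)) * he +
        ((n * p + q * m) * (z.1 + z.2)) * he2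
    set l1 := -e * ((m : ℝ) ^ 2 * (z.1 + z.2) - (p : ℝ) ^ 2 * (1 + z.2)) - (n * p + q * m) * z.2
    set l2 := e * ((n : ℝ) ^ 2 * (z.1 + z.2) - (q : ℝ) ^ 2 * (1 + z.2)) - (n * p + q * m) * z.2
    -- The linear form l1 vanishes on the side from `axisPoint p m` to the tangency point, and l2 on
    -- the side from `axisPoint q n`; each weighs the opposite vertex.
    have key := mem_convexHull_triple (P := axisPoint p m) (Q := axisPoint q n)
      (R := tangencyPoint p m q n) (a := (m : ℝ) ^ 2 * l2 / (n * p + q * m))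
      (b := (n : ℝ) ^ 2 * l1 / (n * p + q * m)) (c := z.2 * ((m : ℝ) ^ 2 + (n : ℝ) ^ 2 - 1))
      (by positivity) (by positivity) (by positivity)
      (by rw [← add_div, hsum]; field_simp; ring)
    convert key using 1
    ext
    · simp only [axisPoint, tangencyPoint, Prod.fst_add, Prod.smul_fst, smul_eq_mul]
      have : (m : ℝ) ^ 2 * l2 / (n * p + q * m) * ((p : ℝ) ^ 2 / (m : ℝ) ^ 2) +
          (n : ℝ) ^ 2 * l1 / (n * p + q * m) * ((q : ℝ) ^ 2 / (n : ℝ) ^ 2) =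
          ((p : ℝ) ^ 2 * l2 + (q : ℝ) ^ 2 * l1) / (n * p + q * m) := by
        field_simp
      rw [this, hfst]
      field_simp
      ring
    · simp only [axisPoint, tangencyPoint, Prod.snd_add, Prod.smul_snd, smul_eq_mul]
      field_simp
      ring
  · rintro (h1 | h1)
    · exact (binForm_lt_of_mem_inside h.snd_ne_zero h1).2.2.not_ge hA
    · exact (binForm_lt_of_mem_inside h'.snd_ne_zero h1).2.2.not_ge hD

/-! Position of the regions in the unit square. -/

lemma Reduced.lt_of_two_le {p m : ℕ} (h : Reduced p m) (hm : 2 ≤ m) : p < m := by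
  refine h.2.lt_of_ne ?_
  rintro rfl
  have := h.1
  simp at this
  lia

/-- Comparing (p,m) with (0,1) gives x ≥ 0. Since p < m, the larger coefficient falls on (0,1), so
f(0,1) < f(1,0), that is x < 1, when y > 0. On the axis the region has only its contact point. -/
theorem region_subset_square {p m : ℕ} (h : Reduced p m) (hm : 2 ≤ m) (hp : 1 ≤ p) :
    region p m ⊆ square := by
  intro z hz
  have hp0 : p ≠ 0 := by lia
  have hp1 : (1 : ℝ) ≤ p := by exact_mod_cast hp
  have hpm : (p : ℝ) + 1 ≤ m := by exact_mod_cast h.lt_of_two_le hm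
  obtain ⟨hS, hy, hf⟩ := binForm_le_of_mem_region hp0 h.snd_ne_zero hz
  have hform := (mem_region_iff hp0).1 hz
  have hy1 := (bounds_of_form_nonpos hp0 h.snd_ne_zero hform).2
  have hx0 : z.2 ≤ binForm z 0 1 := le_binForm hS hy hf (by nlinarith)
  refine ⟨?_, ?_, hy, ?_⟩
  · simp only [binForm] at hx0
    linarith
  · rcases hy.eq_or_lt with hy0 | hy0
    · have hE : z ∈ E p m ∩ xAxis := by
        refine ⟨?_, hy0.symm⟩
        rw [mem_E_iff hp0]
        refine le_antisymm hform ?_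
        rw [form_eq hp0 h.snd_ne_zero, ← hy0]
        simp only [mul_zero, zero_div, zero_mul, add_zero]
        positivity
      rw [E_inter_xAxis h] at hE
      rw [Set.mem_singleton_iff.1 hE]
      simp only [axisPoint]
      rw [div_le_one (by positivity)]
      nlinarith
    · have := binForm_lt_of_small hS hy0 (i := m) (j := p) (a := 0) (b := 1) (c := 1) (d := 0)
        (by norm_num) hpm hp1 (by simpa using hf)
      simp only [binForm] at this
      linarith
  · have h1 : (0 : ℝ) ≤ (m : ℝ) ^ 2 - 2 := by nlinarith
    linarith [mul_nonneg h1 hy]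

/-! The Apollonian process in terms of the binary form. -/

/-- The value of `binForm` at an integral vector. -/
noncomputable def val (z : ℝ × ℝ) (u : ℕ × ℕ) : ℝ := binForm z u.1 u.2

/-- The value of `binPair` at two integral vectors. -/
noncomputable def pairing (z : ℝ × ℝ) (u v : ℕ × ℕ) : ℝ := binPair z u.1 u.2 v.1 v.2

/-- The triple of the Apollonian process attached to two neighbours in the Stern–Brocot array. -/
noncomputable def triple (z : ℝ × ℝ) (u v : ℕ × ℕ) : ℝ × ℝ × ℝ :=
  (val z u - z.2, val z v - z.2, z.2)

lemma val_add (z : ℝ × ℝ) (u v : ℕ × ℕ) :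
    val z (u + v) = val z u + val z v + 2 * pairing z u v := by
  simp only [val, pairing, Prod.fst_add, Prod.snd_add, Nat.cast_add]
  exact binForm_add ..

lemma pairing_add_left (z : ℝ × ℝ) (u v : ℕ × ℕ) :
    pairing z (u + v) v = pairing z u v + val z v := by
  simp only [val, pairing, binForm, binPair, Prod.fst_add, Prod.snd_add, Nat.cast_add]
  ring

lemma pairing_add_right (z : ℝ × ℝ) (u v : ℕ × ℕ) :
    pairing z u (u + v) = pairing z u v + val z u := by
  simp only [val, pairing, binForm, binPair, Prod.fst_add, Prod.snd_add, Nat.cast_add]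
  ring

lemma val_mul_val {z : ℝ × ℝ} (hS : 0 ≤ disc z) {u v : ℕ × ℕ}
    (h : u.1 * v.2 = u.2 * v.1 + 1) : val z u * val z v = pairing z u v ^ 2 + z.2 ^ 2 := by
  have h' : (u.1 : ℝ) * v.2 - u.2 * v.1 = 1 := by
    have : (u.1 : ℝ) * v.2 = u.2 * v.1 + 1 := by exact_mod_cast h
    linarith
  simp only [val, pairing]
  rw [binForm_mul hS, h']
  ring

/-- The expression under the root telescopes to f(u)f(v) − y² = B². -/
lemma sqrt_triple {z : ℝ × ℝ} (hS : 0 ≤ disc z) {u v : ℕ × ℕ}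
    (h : u.1 * v.2 = u.2 * v.1 + 1) (hB : pairing z u v ≤ 0) :
    √((val z u - z.2) * (val z v - z.2) + (val z v - z.2) * z.2 + z.2 * (val z u - z.2)) =
      -pairing z u v := by
  rw [show (val z u - z.2) * (val z v - z.2) + (val z v - z.2) * z.2 + z.2 * (val z u - z.2) =
    (-pairing z u v) ^ 2 by linear_combination val_mul_val hS h]
  exact Real.sqrt_sq (by linarith)

lemma apStep_mk (a b c : ℝ) : apStep (a, b, c) =
    if b ≤ a ∧ c ≤ a then (a + b + c - 2 * √(a * b + b * c + c * a), b, c)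
    else if c ≤ b then (a, a + b + c - 2 * √(a * b + b * c + c * a), c)
    else (a, b, a + b + c - 2 * √(a * b + b * c + c * a)) := rfl

lemma apStep_triple_fst {z : ℝ × ℝ} (hS : 0 ≤ disc z) {u v : ℕ × ℕ}
    (h : u.1 * v.2 = u.2 * v.1 + 1) (hB : pairing z u v ≤ 0) (huv : val z v ≤ val z u)
    (hu : 2 * z.2 ≤ val z u) : apStep (triple z u v) = triple z (u + v) v := by
  rw [triple, apStep_mk, if_pos ⟨by linarith, by linarith⟩, sqrt_triple hS h hB, triple, val_add]
  congr 1
  ring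

lemma apStep_triple_snd {z : ℝ × ℝ} (hS : 0 ≤ disc z) {u v : ℕ × ℕ}
    (h : u.1 * v.2 = u.2 * v.1 + 1) (hB : pairing z u v ≤ 0) (huv : val z u < val z v)
    (hv : 2 * z.2 ≤ val z v) : apStep (triple z u v) = triple z u (u + v) := by
  rw [triple, apStep_mk, if_neg (fun h => by linarith [h.1]), if_pos (by linarith), sqrt_triple hS h hB, triple, val_add]
  congr 2
  ring

lemma stops_triple_iff {z : ℝ × ℝ} (hy : 0 < z.2) {u v : ℕ × ℕ} :
    Stops (triple z u v) ↔ val z u ≤ z.2 ∨ val z v ≤ z.2 := by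
  simp only [Stops, triple, sub_nonpos, hy.not_ge, or_false]

/-- Whichever entry is replaced, the new one is the value at the mediant. -/
lemma stops_apStep_triple_iff {z : ℝ × ℝ} (hS : 0 ≤ disc z) (hy : 0 < z.2) {u v : ℕ × ℕ}
    (h : u.1 * v.2 = u.2 * v.1 + 1) (hB : pairing z u v ≤ 0)
    (hs : ¬ Stops (triple z u v)) :
    Stops (apStep (triple z u v)) ↔ val z (u + v) ≤ z.2 := by
  rw [stops_triple_iff hy] at hs
  push Not at hs
  obtain ⟨hu, hv⟩ := hs
  have hnew : val z u - z.2 + (val z v - z.2) + z.2 -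
      2 * √((val z u - z.2) * (val z v - z.2) + (val z v - z.2) * z.2 + z.2 * (val z u - z.2)) =
      val z (u + v) - z.2 := by
    rw [sqrt_triple hS h hB, val_add]; ring
  rw [triple, apStep_mk, hnew]
  split_ifs <;> simp only [Stops, sub_nonpos, hy.not_ge, hu.not_ge, hv.not_ge, or_false, false_or]

lemma delta_eq_iff {z : ℝ × ℝ} {k : ℕ} :
    delta z = k ↔ Stops (apStep^[k] (1, z.1, z.2)) ∧
      ∀ j < k, ¬ Stops (apStep^[j] (1, z.1, z.2)) := by
  have hle : ∀ n, Stops (apStep^[n] (1, z.1, z.2)) → delta z ≤ n := fun n hn => iInf₂_le n hn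
  constructor
  · intro h
    have hmin : ∀ j < k, ¬ Stops (apStep^[j] (1, z.1, z.2)) := by
      intro j hj hs
      have := hle j hs
      rw [h] at this
      exact absurd (by exact_mod_cast this) (not_le.2 hj)
    refine ⟨?_, hmin⟩
    by_contra hk
    have : ((k + 1 : ℕ) : ℕ∞) ≤ delta z := by
      refine le_iInf₂ fun n hn => ?_
      have : k + 1 ≤ n := by
        by_contra! hlt
        rcases (Nat.lt_succ_iff.1 hlt).eq_or_lt with rfl | hlt
        · exact hk hn
        · exact hmin n hlt hn
      exact_mod_cast this
    rw [h] at this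
    have : k + 1 ≤ k := by exact_mod_cast this
    lia
  · rintro ⟨h1, h2⟩
    refine le_antisymm (hle k h1) (le_iInf₂ fun n hn => ?_)
    have : k ≤ n := by
      by_contra! hlt
      exact h2 n hlt hn
    exact_mod_cast this

lemma apStep_iterate_zero {z : ℝ × ℝ} :
    apStep^[0] (1, z.1, z.2) = triple z (1, 0) (0, 1) := by
  simp [triple, val, binForm]

lemma pairing_root (z : ℝ × ℝ) : pairing z (1, 0) (0, 1) = -√(disc z) := by
  simp [pairing, binPair]

/-! ### Open sets of points with a common itinerary -/

lemma continuous_disc : Continuous disc := by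
  unfold disc; fun_prop

lemma continuous_val (u : ℕ × ℕ) : Continuous fun z => val z u := by
  unfold val binForm disc; fun_prop

lemma continuous_pairing (u v : ℕ × ℕ) : Continuous fun z => pairing z u v := by
  unfold pairing binPair disc; fun_prop

/-- For the points of the open set `U` the process visits after `k` steps the triple of the
neighbours `u, v` of row `k`. -/
structure IsTrack (k : ℕ) (u v : ℕ × ℕ) (U : Set (ℝ × ℝ)) : Prop where
  pair : SBPair k u v
  isOpen : IsOpen U
  disc_nonneg : ∀ z ∈ U, 0 ≤ disc z
  pos : ∀ z ∈ U, 0 < z.2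
  iterate : ∀ z ∈ U, apStep^[k] (1, z.1, z.2) = triple z u v
  neg : ∀ z ∈ U, pairing z u v < 0

lemma isTrack_root : IsTrack 0 (1, 0) (0, 1) {z | 0 < z.2 ∧ 0 < disc z} where
  pair := .root
  isOpen := (isOpen_lt continuous_const continuous_snd).inter
    (isOpen_lt continuous_const continuous_disc)
  disc_nonneg _ hz := hz.2.le
  pos _ hz := hz.1
  iterate _ _ := apStep_iterate_zero
  neg z hz := by
    rw [pairing_root, neg_lt_zero]
    exact Real.sqrt_pos.2 hz.2

/-- Strict inequalities keep the set open. Discarding ties costs nothing, since points of a target's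
region satisfy them strictly. -/
lemma IsTrack.fst {k : ℕ} {u v : ℕ × ℕ} {U : Set (ℝ × ℝ)} (h : IsTrack k u v U) :
    IsTrack (k + 1) (u + v) v
      {z ∈ U | val z v < val z u ∧ 2 * z.2 < val z u ∧ pairing z (u + v) v < 0} where
  pair := h.pair.fst
  isOpen := h.isOpen.inter ((isOpen_lt (continuous_val v) (continuous_val u)).inter
    ((isOpen_lt (by fun_prop) (continuous_val u)).inter
      (isOpen_lt (continuous_pairing _ _) continuous_const)))
  disc_nonneg z hz := h.disc_nonneg z hz.1
  pos z hz := h.pos z hz.1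
  iterate z hz := by
    rw [Function.iterate_succ_apply', h.iterate z hz.1]
    exact apStep_triple_fst (h.disc_nonneg z hz.1) h.pair.det (h.neg z hz.1).le hz.2.1.le hz.2.2.1.le
  neg z hz := hz.2.2.2

lemma IsTrack.snd {k : ℕ} {u v : ℕ × ℕ} {U : Set (ℝ × ℝ)} (h : IsTrack k u v U) :
    IsTrack (k + 1) u (u + v)
      {z ∈ U | val z u < val z v ∧ 2 * z.2 < val z v ∧ pairing z u (u + v) < 0} where
  pair := h.pair.snd
  isOpen := h.isOpen.inter ((isOpen_lt (continuous_val u) (continuous_val v)).inter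
    ((isOpen_lt (by fun_prop) (continuous_val v)).inter
      (isOpen_lt (continuous_pairing _ _) continuous_const)))
  disc_nonneg z hz := h.disc_nonneg z hz.1
  pos z hz := h.pos z hz.1
  iterate z hz := by
    rw [Function.iterate_succ_apply', h.iterate z hz.1]
    exact apStep_triple_snd (h.disc_nonneg z hz.1) h.pair.det (h.neg z hz.1).le hz.2.1 hz.2.2.1.le
  neg z hz := hz.2.2.2

lemma SBPair.det_real {k : ℕ} {u v : ℕ × ℕ} (h : SBPair k u v) :
    (u.1 : ℝ) * v.2 - u.2 * v.1 = 1 := by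
  have : (u.1 : ℝ) * v.2 = u.2 * v.1 + 1 := by exact_mod_cast h.det
  linarith

lemma IsTrack.not_stops {k : ℕ} {u v : ℕ × ℕ} {U : Set (ℝ × ℝ)} (h : IsTrack k u v U)
    {i j : ℕ} (hi : 1 ≤ i) (hj : 1 ≤ j) {z : ℝ × ℝ} (hz : z ∈ U)
    (ht : val z (i • u + j • v) < z.2) : ¬ Stops (apStep^[k] (1, z.1, z.2)) := by
  have hi' : (1 : ℝ) ≤ i := by exact_mod_cast hi
  have hj' : (1 : ℝ) ≤ j := by exact_mod_cast hj
  have hdet := h.pair.det_real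
  rw [h.iterate z hz, stops_triple_iff (h.pos z hz)]
  push Not
  constructor
  · refine lt_binForm (h.disc_nonneg z hz) (h.pos z hz) ht ?_
    have : ((i • u + j • v).1 : ℝ) * u.2 - (i • u + j • v).2 * u.1 = -j := by
      simp; linear_combination (-(j : ℝ)) * hdet
    rw [this]; nlinarith
  · refine lt_binForm (h.disc_nonneg z hz) (h.pos z hz) ht ?_
    have : ((i • u + j • v).1 : ℝ) * v.2 - (i • u + j • v).2 * v.1 = i := by
      simp; linear_combination (i : ℝ) * hdet
    rw [this]; nlinarith

/-- Every coprime combination of neighbours is the mediant of later neighbours, and near the region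
of the target the process follows the path leading to them. -/
lemma IsTrack.exists_target {N : ℕ} : ∀ {i j : ℕ}, i + j ≤ N → Nat.Coprime i j → 1 ≤ i → 1 ≤ j →
    ∀ {k : ℕ} {u v : ℕ × ℕ} {U : Set (ℝ × ℝ)}, IsTrack k u v U →
    ∃ k' u' v' U', IsTrack k' u' v' U' ∧ u' + v' = i • u + j • v ∧
      (∀ z ∈ U, val z (i • u + j • v) ≤ z.2 → z ∈ U') ∧
      (∀ z ∈ U, val z (i • u + j • v) < z.2 →
        (∀ l < k, ¬ Stops (apStep^[l] (1, z.1, z.2))) →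
        ∀ l < k', ¬ Stops (apStep^[l] (1, z.1, z.2))) := by
  induction N with
  | zero => intro i j h; lia
  | succ N ih =>
    intro i j hN hc hi hj k u v U h
    have hi' : (1 : ℝ) ≤ i := by exact_mod_cast hi
    have hj' : (1 : ℝ) ≤ j := by exact_mod_cast hj
    have hdet := h.pair.det_real
    have hdet2 : (1 : ℝ) ≤ ((u.1 : ℝ) * v.2 - u.2 * v.1) ^ 2 := by rw [hdet]; norm_num
    have hval : ∀ z, val z (i • u + j • v) = binForm z (i * u.1 + j * v.1) (i * u.2 + j * v.2) := by
      intro z; simp [val]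
    -- Strict smallness at the target is essential: at a tangency with E[u] or E[v] an entry is
    -- already zero and the process stops earlier.
    have hprev : ∀ z ∈ U, val z (i • u + j • v) < z.2 →
        (∀ l < k, ¬ Stops (apStep^[l] (1, z.1, z.2))) →
        ∀ l < k + 1, ¬ Stops (apStep^[l] (1, z.1, z.2)) := by
      intro z hz ht hl l hlk
      rcases (Nat.lt_succ_iff.1 hlk).eq_or_lt with rfl | hlk
      · exact h.not_stops hi hj hz ht
      · exact hl l hlk
    -- Subtractive Euclid: for i < j the target is i(u+v) + (j−i)v, and its larger coefficient on v
    -- makes f(u) the greater value. Its determinant with u has absolute value j ≥ 2, whence f(u) >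
    -- 2y, so y is not the entry replaced. The case i > j is symmetric.
    rcases lt_trichotomy i j with hij | hij | hij
    · obtain ⟨d, rfl⟩ : ∃ d, j = i + d := ⟨j - i, by lia⟩
      have hd : 1 ≤ d := by lia
      have hd' : (1 : ℝ) ≤ d := by exact_mod_cast hd
      have heq : i • (u + v) + d • v = i • u + (i + d) • v := by
        rw [smul_add, add_smul]; abel
      obtain ⟨k', u', v', U', hT, huv, hU, hst⟩ := ih (i := i) (j := d) (by lia)
        (by simpa using hc) hi hd h.fst
      rw [heq] at huv hU hst
      have hmem : ∀ z ∈ U, val z (i • u + (i + d) • v) ≤ z.2 →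
          z ∈ {z ∈ U | val z v < val z u ∧ 2 * z.2 < val z u ∧ pairing z (u + v) v < 0} := by
        intro z hz ht
        have hS := h.disc_nonneg z hz
        have hy := h.pos z hz
        refine ⟨hz, ?_, ?_, ?_⟩
        · rw [hval] at ht
          refine binForm_lt_of_small hS hy (i := (i + d : ℕ)) (j := i) ?_ (by push_cast; linarith) hi'
            (by rwa [add_comm, add_comm _ ((i : ℝ) * u.2)])
          rw [show (v.1 : ℝ) * u.2 - v.2 * u.1 = -1 by linarith]; norm_num
        · rw [hval] at ht
          refine two_mul_lt_binForm hS hy ht ?_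
          rw [show ((i : ℝ) * u.1 + (i + d : ℕ) * v.1) * u.2 - (i * u.2 + (i + d : ℕ) * v.2) * u.1 =
            -(i + d : ℕ) by linear_combination (-((i + d : ℕ) : ℝ)) * hdet]
          push_cast; nlinarith
        · rw [← heq] at ht
          simp only [val, pairing] at ht ⊢
          refine binPair_neg hS hy (i := i) (j := d) ?_ hi' hd' (by simpa [mul_add] using ht)
          have : ((u + v).1 : ℝ) * v.2 - (u + v).2 * v.1 = 1 := by
            simp; linear_combination hdet
          rw [this]; norm_num
      exact ⟨k', u', v', U', hT, huv, fun z hz ht => hU z (hmem z hz ht) ht,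
        fun z hz ht hl => hst z (hmem z hz ht.le) ht (hprev z hz ht hl)⟩
    · subst hij
      have : i = 1 := by simpa using hc
      subst this
      exact ⟨k, u, v, U, h, by simp, fun z hz _ => hz, fun z _ _ hl => hl⟩
    · obtain ⟨d, rfl⟩ : ∃ d, i = j + d := ⟨i - j, by lia⟩
      have hd : 1 ≤ d := by lia
      have hd' : (1 : ℝ) ≤ d := by exact_mod_cast hd
      have heq : d • u + j • (u + v) = (j + d) • u + j • v := by
        rw [smul_add, add_smul]; abel
      obtain ⟨k', u', v', U', hT, huv, hU, hst⟩ := ih (i := d) (j := j) (by lia)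
        (by simpa using hc) hd hj h.snd
      rw [heq] at huv hU hst
      have hmem : ∀ z ∈ U, val z ((j + d) • u + j • v) ≤ z.2 →
          z ∈ {z ∈ U | val z u < val z v ∧ 2 * z.2 < val z v ∧ pairing z u (u + v) < 0} := by
        intro z hz ht
        have hS := h.disc_nonneg z hz
        have hy := h.pos z hz
        refine ⟨hz, ?_, ?_, ?_⟩
        · rw [hval] at ht
          exact binForm_lt_of_small hS hy hdet2 (by push_cast; linarith) hj' ht
        · rw [hval] at ht
          refine two_mul_lt_binForm hS hy ht ?_
          rw [show ((j + d : ℕ) * (u.1 : ℝ) + j * v.1) * v.2 - ((j + d : ℕ) * u.2 + j * v.2) * v.1 =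
            (j + d : ℕ) by linear_combination ((j + d : ℕ) : ℝ) * hdet]
          push_cast; nlinarith
        · rw [← heq] at ht
          simp only [val, pairing] at ht ⊢
          refine binPair_neg hS hy (i := d) (j := j) ?_ hd' hj' (by simpa [mul_add] using ht)
          have : (u.1 : ℝ) * (u + v).2 - u.2 * (u + v).1 = 1 := by
            simp; linear_combination hdet
          rw [this]; norm_num
      exact ⟨k', u', v', U', hT, huv, fun z hz ht => hU z (hmem z hz ht) ht,
        fun z hz ht hl => hst z (hmem z hz ht.le) ht (hprev z hz ht hl)⟩

/-! Plateaus. -/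

lemma square_convex : Convex ℝ square := by
  have : square = Set.Icc (0 : ℝ) 1 ×ˢ Set.Icc (0 : ℝ) 1 := by
    ext z; simp only [square, Set.mem_ofPred_eq, Set.mem_prod, Set.mem_Icc, and_assoc]
  rw [this]
  exact (convex_Icc _ _).prod (convex_Icc _ _)

/-- The open segment from a point of the region to an interior point lies in the interior. -/
lemma form_segment_neg {p m : ℕ} (hp : p ≠ 0) (hm : m ≠ 0) {z w : ℝ × ℝ} (hz : form p m z ≤ 0)
    (hw : form p m w < 0) {a b : ℝ} (ha : 0 ≤ a) (hb : 0 < b) (hab : a + b = 1) :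
    form p m (a • z + b • w) < 0 := by
  have hm1 : (1 : ℝ) ≤ m := by exact_mod_cast Nat.one_le_iff_ne_zero.2 hm
  have key : a * form p m z + b * form p m w - form p m (a • z + b • w) = a * b *
      (((m : ℝ) / p * (z.1 - w.1) + ((m : ℝ) ^ 2 - (p : ℝ) ^ 2 - 1) / (p * m) * (z.2 - w.2)) ^ 2 +
        4 * ((m : ℝ) ^ 2 - 1) / (m : ℝ) ^ 2 * (z.2 - w.2) ^ 2) := by
    obtain rfl : a = 1 - b := by linarith
    rw [form_eq hp hm, form_eq hp hm, form_eq hp hm]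
    simp only [Prod.fst_add, Prod.snd_add, Prod.smul_fst, Prod.smul_snd, smul_eq_mul]
    ring
  have h1 : 0 ≤ 4 * ((m : ℝ) ^ 2 - 1) / (m : ℝ) ^ 2 * (z.2 - w.2) ^ 2 := by
    have : (0 : ℝ) ≤ (m : ℝ) ^ 2 - 1 := by nlinarith
    positivity
  have h2 : 0 ≤ a * b *
      (((m : ℝ) / p * (z.1 - w.1) + ((m : ℝ) ^ 2 - (p : ℝ) ^ 2 - 1) / (p * m) * (z.2 - w.2)) ^ 2 +
        4 * ((m : ℝ) ^ 2 - 1) / (m : ℝ) ^ 2 * (z.2 - w.2) ^ 2) := by positivity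
  nlinarith [mul_nonpos_of_nonneg_of_nonpos ha hz, mul_neg_of_pos_of_neg hb hw]

lemma isClosed_region {p m : ℕ} (hp : p ≠ 0) : IsClosed (region p m) := by
  have : region p m = {z | form p m z ≤ 0} := by ext z; exact mem_region_iff hp
  rw [this]
  exact isClosed_le (by unfold form; fun_prop) continuous_const

lemma inside_inter_square_nonempty {p m : ℕ} (h : Reduced p m) (hp : 1 ≤ p) :
    (inside p m ∩ square).Nonempty := by
  have hp0 : p ≠ 0 := by lia
  by_cases hm : 2 ≤ m
  · obtain ⟨φ, -, hφ⟩ := isEllipse_E hp hm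
    have h0 : φ 0 ∈ inside p m := by
      rw [← hφ]
      exact ⟨0, by simp, rfl⟩
    exact ⟨φ 0, h0, region_subset_square h hm hp (Or.inr h0)⟩
  · have hm1 : m = 1 := by have := h.2; lia
    have hp1 : p = 1 := by have := h.2; lia
    subst hm1 hp1
    refine ⟨(1, 1 / 2), ?_, ?_⟩
    · rw [mem_inside_iff one_ne_zero, form_eq one_ne_zero one_ne_zero]
      norm_num
    · simp only [square, Set.mem_ofPred_eq]
      norm_num

lemma pos_of_mem_levelSet {k : ℕ} (hk : 1 ≤ k) {z : ℝ × ℝ} (hz : z ∈ levelSet k) : 0 < z.2 := by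
  have := (delta_eq_iff.1 hz.2).2 0 (by lia)
  by_contra! h
  exact this (Or.inr (Or.inr h))

lemma disc_pos_of_mem_square {z : ℝ × ℝ} (hz : z ∈ square) (hy : 0 < z.2) : 0 < disc z := by
  obtain ⟨hx, -, -, -⟩ := hz
  simp only [disc]
  positivity

/-- If `disc` vanished, so would the cross term, and f(p,m) would equal f(p,−m) > y. -/
lemma disc_pos_of_form_nonpos {p m : ℕ} (hp : p ≠ 0) (hm : m ≠ 0) {z : ℝ × ℝ} (hy : 0 < z.2)
    (hz : form p m z ≤ 0) : 0 < disc z := by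
  have hS := disc_nonneg_of_form_nonpos hp hm hz
  refine hS.lt_of_ne fun h0 => ?_
  have h1 := (form_nonpos_iff hp hm hS hy.le).1 hz
  have h2 := conjugate_pos m hp hS hy.le
  simp only [binForm, ← h0, Real.sqrt_zero] at h1 h2
  linarith

/-- The main facts about the plateau of a reduced fraction `p/m > 0`. -/
lemma exists_row {p m : ℕ} (h : Reduced p m) (hp : 1 ≤ p) :
    ∃ k, 1 ≤ k ∧ IsSBRow k (p, m) ∧ (∀ z ∈ inside p m, delta z = (k : ℕ∞)) ∧
      ∃ U, IsOpen U ∧ (∀ z ∈ region p m, 0 < z.2 → z ∈ U) ∧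
        U ∩ levelSet k ⊆ region p m := by
  have hp0 : p ≠ 0 := by lia
  have hm0 := h.snd_ne_zero
  obtain ⟨K, u, v, U, hT, huv, hU, hst⟩ := isTrack_root.exists_target (N := p + m) (i := p) (j := m)
    le_rfl h.1 hp (Nat.one_le_iff_ne_zero.2 hm0)
  have ht : p • ((1, 0) : ℕ × ℕ) + m • ((0, 1) : ℕ × ℕ) = (p, m) := by simp
  rw [ht] at huv hU hst
  have hval : ∀ z, val z (p, m) = binForm z p m := fun z => rfl
  -- The neighbours u, v stand in row K; their mediant (p,m) appears, and its entry is produced, one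
  -- step later.
  refine ⟨K + 1, by lia, huv ▸ hT.pair.isSBRow_add, fun z hz => ?_, U, hT.isOpen, fun z hz hy => ?_,
    fun z hz => ?_⟩
  · obtain ⟨hS, hy, hf⟩ := binForm_lt_of_mem_inside hm0 hz
    have hroot : z ∈ {z : ℝ × ℝ | 0 < z.2 ∧ 0 < disc z} :=
      ⟨hy, disc_pos_of_form_nonpos hp0 hm0 hy ((mem_inside_iff hp0).1 hz).le⟩
    have hzU := hU z hroot hf.le
    have hK : ¬ Stops (apStep^[K] (1, z.1, z.2)) := by
      refine hT.not_stops (i := 1) (j := 1) le_rfl le_rfl hzU ?_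
      rw [one_smul, one_smul, huv]
      exact hf
    have hlt := hst z hroot hf (by simp)
    refine delta_eq_iff.2 ⟨?_, fun j hj => ?_⟩
    · rw [hT.iterate z hzU] at hK
      rw [Function.iterate_succ_apply', hT.iterate z hzU,
        stops_apStep_triple_iff hS hy hT.pair.det (hT.neg z hzU).le hK, huv]
      exact hf.le
    · rcases (Nat.lt_succ_iff.1 hj).eq_or_lt with rfl | hj
      · exact hK
      · exact hlt j hj
  · obtain ⟨hS, -, hf⟩ := binForm_le_of_mem_region hp0 hm0 hz
    exact hU z ⟨hy, disc_pos_of_form_nonpos hp0 hm0 hy ((mem_region_iff hp0).1 hz)⟩ hf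
  · obtain ⟨hzU, hz⟩ := hz
    obtain ⟨h1, h2⟩ := delta_eq_iff.1 hz.2
    have hK := h2 K (Nat.lt_succ_self K)
    have hS := hT.disc_nonneg z hzU
    have hy := hT.pos z hzU
    rw [hT.iterate z hzU] at hK
    rw [Function.iterate_succ_apply', hT.iterate z hzU,
        stops_apStep_triple_iff hS hy hT.pair.det (hT.neg z hzU).le hK, huv] at h1
    rw [mem_region_iff hp0, form_nonpos_iff hp0 hm0 hS hy.le]
    exact h1

/-- The plateau through any point of the region of `p/m` on the right level coincides with the
region. -/
lemma exists_row_coincides {p m : ℕ} (h : Reduced p m) (hp : 1 ≤ p) :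
    ∃ k, IsSBRow k (p, m) ∧ (∀ z ∈ inside p m, delta z = (k : ℕ∞)) ∧
      ∀ z ∈ levelSet k ∩ region p m, Coincides (connectedComponentIn (levelSet k) z) p m := by
  have hp0 : p ≠ 0 := by lia
  have hm0 := h.snd_ne_zero
  obtain ⟨k, hk1, hrow, hin, U, hUo, hU, hUsub⟩ := exists_row h hp
  have hlev : inside p m ∩ square ⊆ levelSet k := fun z hz => ⟨hz.2, hin z hz.1⟩
  refine ⟨k, hrow, hin, fun z hz => ⟨fun w hw => ?_, fun w hw => ?_⟩⟩
  · have hseg : segment ℝ z w ⊆ levelSet k := by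
      rintro _ ⟨a, b, ha, hb, hab, rfl⟩
      rcases hb.eq_or_lt with rfl | hb
      · obtain rfl : a = 1 := by linarith
        simpa using hz.1
      · exact hlev ⟨(mem_inside_iff hp0).2 (form_segment_neg hp0 hm0 ((mem_region_iff hp0).1 hz.2)
          ((mem_inside_iff hp0).1 hw.1) ha hb hab), square_convex hz.1.1 hw.2 ha hb.le hab⟩
    exact (convex_segment z w).isPreconnected.subset_connectedComponentIn
      (left_mem_segment ℝ z w) hseg (right_mem_segment ℝ z w)
  · have hsub := connectedComponentIn_subset (levelSet k) z
    have hpre : IsPreconnected (connectedComponentIn (levelSet k) z) :=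
      isPreconnected_connectedComponentIn
    -- The open set U and the complement of the region cover the component and have no common point
    -- on the level set, so connectedness leaves only U.
    have hcov : connectedComponentIn (levelSet k) z ⊆ U ∪ (region p m)ᶜ := by
      intro x hx
      by_cases hxr : x ∈ region p m
      · exact Or.inl (hU x hxr (pos_of_mem_levelSet hk1 (hsub hx)))
      · exact Or.inr hxr
    have hdis : connectedComponentIn (levelSet k) z ∩ (U ∩ (region p m)ᶜ) = ∅ := by
      rw [Set.eq_empty_iff_forall_notMem]
      rintro x ⟨hx, hxU, hxr⟩
      exact hxr (hUsub ⟨hxU, hsub hx⟩)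
    rcases isPreconnected_iff_subset_of_disjoint.1 hpre U (region p m)ᶜ hUo
      (isClosed_region hp0).isOpen_compl hcov hdis with h1 | h1
    · exact ⟨hUsub ⟨h1 hw, hsub hw⟩, (hsub hw).1⟩
    · exact absurd hz.2 (h1 (mem_connectedComponentIn hz.1))

/-! Plateaus that reach the axis. -/

/-- This keeps the next pairing e = B + D nonpositive, so the root can be read off again. Positivity
of (D−c)(A+D+2B−c) says cA < (e−c)² + c²; with A ≥ 2c this excludes 0 < e ≤ c. But e > 0 would give
eA ≤ c², hence e ≤ c. -/
lemma obtuse_algebra {A D B c : ℝ} (hc : 0 < c) (hdet : A * D = B ^ 2 + c ^ 2) (hB : B ≤ 0)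
    (hDA : D ≤ A) (hD : c < D) (hA : 2 * c ≤ A) (hw : c < A + D + 2 * B) : B + D ≤ 0 := by
  by_contra! he
  have h1 : 0 < (-B - (c - (B + D))) * ((A + B) - (c - (B + D))) :=
    mul_pos (by linarith) (by linarith)
  have h2 : 0 ≤ (-B) * (A + B) := mul_nonneg (by linarith) (by linarith)
  have h3 : (B + D) * A = c ^ 2 - (-B) * (A + B) := by linear_combination hdet
  have h4 : B + D ≤ c := by
    by_contra! h5
    nlinarith
  have h5 : (B + D) * (B + D) ≤ (B + D) * c := mul_le_mul_of_nonneg_left h4 he.le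
  have h6 : c * (2 * c) ≤ c * A := mul_le_mul_of_nonneg_left hA hc.le
  nlinarith [mul_pos he hc]

lemma add_fst_le_snd {u v : ℕ × ℕ} (hu : u = (1, 0) ∧ v = (0, 1) ∨ u.1 ≤ u.2) (hv : v.1 ≤ v.2) :
    (u + v).1 ≤ (u + v).2 := by
  rcases hu with ⟨rfl, rfl⟩ | hu
  · simp
  · exact add_le_add hu hv

/-- Close to the axis the process replaces the third entry only after more than `K` steps. -/
lemma exists_pair_of_low {z : ℝ × ℝ} (hz : z ∈ square) {K : ℕ} (hy : 0 < z.2)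
    (hlow : 2 * z.2 * 4 ^ K < 1) (hns : ∀ j ≤ K, ¬ Stops (apStep^[j] (1, z.1, z.2))) :
    ∃ u v, SBPair K u v ∧ (u = (1, 0) ∧ v = (0, 1) ∨ u.1 ≤ u.2) ∧ v.1 ≤ v.2 ∧ u.2 + v.2 ≤ 2 ^ K ∧
      pairing z u v ≤ 0 ∧ apStep^[K] (1, z.1, z.2) = triple z u v := by
  have hS := (disc_pos_of_mem_square hz hy).le
  induction K with
  | zero =>
    refine ⟨(1, 0), (0, 1), .root, Or.inl ⟨rfl, rfl⟩, by simp, by simp, ?_, apStep_iterate_zero⟩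
    rw [pairing_root]
    exact neg_nonpos.2 (Real.sqrt_nonneg _)
  | succ K ih =>
    have h4 : (0 : ℝ) < 4 ^ K := by positivity
    obtain ⟨u, v, hP, huv, hv, hsum, hB, hit⟩ := ih (by rw [pow_succ] at hlow; nlinarith)
      (fun j hj => hns j (by lia))
    have hdet := hP.det
    have hmul := val_mul_val hS hdet
    have hK := hns K (by lia)
    have hK1 := hns (K + 1) le_rfl
    rw [Function.iterate_succ_apply', hit] at hK1
    rw [hit] at hK
    rw [stops_apStep_triple_iff hS hy hdet hB hK] at hK1
    rw [stops_triple_iff hy] at hK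
    push Not at hK hK1
    -- Otherwise f(u), f(v) and −B are all at most 2y, and the dual identity bounds 1 + y by
    -- 2y(u₂+v₂)² ≤ 2y·4^K, contrary to lowness.
    have hmax : 2 * z.2 ≤ val z u ∨ 2 * z.2 ≤ val z v := by
      by_contra! hlt
      have hdual := binForm_dual_snd z u.1 u.2 v.1 v.2
      rw [hP.det_real] at hdual
      change (v.2 : ℝ) ^ 2 * val z u - 2 * u.2 * v.2 * pairing z u v + (u.2 : ℝ) ^ 2 * val z v = _
        at hdual
      have hB2 : -pairing z u v ≤ 2 * z.2 := by nlinarith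
      have hs : ((u.2 : ℝ) + v.2) ^ 2 ≤ 4 ^ K := by
        have : ((u.2 : ℝ) + v.2) ≤ 2 ^ K := by exact_mod_cast hsum
        calc ((u.2 : ℝ) + v.2) ^ 2 ≤ (2 ^ K) ^ 2 := by gcongr
          _ = 4 ^ K := by rw [← pow_mul, mul_comm, pow_mul]; norm_num
      have e1 := mul_le_mul_of_nonneg_left hlt.1.le (sq_nonneg (v.2 : ℝ))
      have e2 := mul_le_mul_of_nonneg_left hlt.2.le (sq_nonneg (u.2 : ℝ))
      have e3 := mul_le_mul_of_nonneg_left hB2 (show (0 : ℝ) ≤ 2 * u.2 * v.2 by positivity)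
      have e4 := mul_le_mul_of_nonneg_left hs hy.le
      rw [pow_succ] at hlow
      nlinarith
    rcases le_or_gt (val z v) (val z u) with hle | hlt
    · have hu2 : 2 * z.2 ≤ val z u := hmax.elim id (fun h => h.trans hle)
      refine ⟨u + v, v, hP.fst, Or.inr (add_fst_le_snd huv hv), hv, ?_, ?_, ?_⟩
      · simp only [Prod.snd_add, pow_succ] at hsum ⊢; lia
      · rw [pairing_add_left]
        rw [val_add] at hK1
        exact obtuse_algebra hy hmul hB hle hK.2 hu2 hK1
      · rw [Function.iterate_succ_apply', hit, apStep_triple_fst hS hdet hB hle hu2]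
    · have hv2 : 2 * z.2 ≤ val z v := hmax.elim (fun h => h.trans hlt.le) id
      -- At the root x ≤ 1, with ties going to the first entry, so the first move cannot lead to
      -- fractions above 1.
      have hu : u.1 ≤ u.2 := by
        refine huv.resolve_left ?_
        rintro ⟨rfl, rfl⟩
        have hx := hz.2.1
        simp [val, binForm] at hlt
        linarith
      refine ⟨u, u + v, hP.snd, Or.inr hu, add_le_add hu hv, ?_, ?_, ?_⟩
      · simp only [Prod.snd_add, pow_succ] at hsum ⊢; lia
      · rw [pairing_add_right]
        rw [val_add] at hK1
        exact obtuse_algebra hy (by rw [mul_comm]; exact hmul) hB hlt.le hK.1 hv2 (by linarith)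
      · rw [Function.iterate_succ_apply', hit, apStep_triple_snd hS hdet hB hlt hv2]

/-- The plateau has a point below height 1/(2·4^K). There the process is still on the array after K
steps, so the stopping entry is f(u+v) − y and the point lies in the region of u+v. -/
lemma exists_coincides_of_closure {k : ℕ} {P : Set (ℝ × ℝ)} (hk : 1 ≤ k) (hP : IsPlateau k P)
    (hcl : (closure P ∩ xAxis).Nonempty) :
    ∃ p m : ℕ, Reduced p m ∧ 1 ≤ p ∧ IsSBRow k (p, m) ∧ Coincides P p m := by
  obtain ⟨z₀, hz₀, rfl⟩ := hP
  obtain ⟨a, ha, hax⟩ := hcl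
  obtain ⟨K, rfl⟩ : ∃ K, k = K + 1 := ⟨k - 1, by lia⟩
  have h4 : (0 : ℝ) < 2 * 4 ^ K := by positivity
  obtain ⟨z, hzlow, hzP⟩ := mem_closure_iff.1 ha {z | z.2 * (2 * 4 ^ K) < 1}
    (isOpen_lt (by fun_prop) continuous_const) (by
      have : a.2 = 0 := hax
      simp [this])
  have hz := connectedComponentIn_subset _ _ hzP
  have hy := pos_of_mem_levelSet hk hz
  have hS := (disc_pos_of_mem_square hz.1 hy).le
  obtain ⟨hlast, hns⟩ := delta_eq_iff.1 hz.2
  obtain ⟨u, v, hpair, hu, hv, -, hB, hit⟩ := exists_pair_of_low hz.1 hy (K := K)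
    (by have : z.2 * (2 * 4 ^ K) < 1 := hzlow
        linarith) (fun j hj => hns j (by lia))
  have hdet := hpair.det
  have hK := hns K (by lia)
  rw [hit] at hK
  rw [Function.iterate_succ_apply', hit, stops_apStep_triple_iff hS hy hdet hB hK] at hlast
  have hred : Reduced (u + v).1 (u + v).2 := by
    refine ⟨coprime_of_cross (q := v.1) (n := v.2) (Or.inl ?_), add_fst_le_snd hu hv⟩
    simp only [Prod.fst_add, Prod.snd_add]
    linarith
  have hpos : 1 ≤ (u + v).1 := by
    have : u.1 ≠ 0 := by
      intro h0
      rw [h0] at hdet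
      lia
    simp only [Prod.fst_add]
    lia
  have hrow : IsSBRow (K + 1) ((u + v).1, (u + v).2) := hpair.isSBRow_add
  obtain ⟨k', hrow', -, hco⟩ := exists_row_coincides hred hpos
  obtain rfl := hrow.unique hrow'
  refine ⟨_, _, hred, hpos, hrow, ?_⟩
  rw [connectedComponentIn_eq hzP]
  refine hco z ⟨hz, ?_⟩
  have hp0 : (u + v).1 ≠ 0 := by lia
  rw [mem_region_iff hp0, form_nonpos_iff hp0 hred.snd_ne_zero hS hy.le]
  exact hlast

lemma delta_eq_zero {z : ℝ × ℝ} (hz : z ∈ E 0 1) : delta z = 0 := by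
  have hz1 : z.1 = 0 := by simpa [E] using hz
  have : delta z = ((0 : ℕ) : ℕ∞) := delta_eq_iff.2 ⟨Or.inr (Or.inl hz1.le), by simp⟩
  simpa using this

theorem theorem1 :
    -- (A)
    ((∀ p m : ℕ, Reduced p m → 1 ≤ p → 2 ≤ m → IsEllipse (E p m) (inside p m)) ∧
      IsParabola (E 1 1) (inside 1 1) ∧
      (∀ p m : ℕ, Reduced p m → E p m ∩ xAxis = {axisPoint p m}) ∧
      (∀ p m : ℕ, Reduced p m → 1 ≤ p →
        (∀ z ∈ region p m, 0 ≤ z.2) ∧ TangentAt (E p m) xAxis (axisPoint p m))) ∧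
    -- (B)
    ((∀ p m q n : ℕ, Reduced p m → Reduced q n → (p, m) ≠ (q, n) →
        Disjoint (inside p m) (inside q n)) ∧
      (∀ p m q n : ℕ, Reduced p m → Reduced q n → DetOne p m q n →
        Reduced (p + q) (m + n) ∧
        IsEllipse (E (p + q) (m + n)) (inside (p + q) (m + n)) ∧
        region (p + q) (m + n) ⊆ gap p m q n ∧
        TangentAt (E (p + q) (m + n)) xAxis (axisPoint (p + q) (m + n)) ∧
        (∃ P, TangentAt (E (p + q) (m + n)) (E p m) P) ∧
        (∃ P, TangentAt (E (p + q) (m + n)) (E q n) P))) ∧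
    -- (C)
    (∀ p m q n : ℕ, Reduced p m → Reduced q n → DetOne p m q n →
      E p m ∩ E q n = {tangencyPoint p m q n} ∧
      TangentAt (E p m) (E q n) (tangencyPoint p m q n)) ∧
    -- (D)
    ((∀ p m : ℕ, Reduced p m → 1 ≤ p →
        ∃ k : ℕ, IsSBRow k (p, m) ∧
          (∀ z ∈ inside p m, delta z = (k : ℕ∞)) ∧
          ∃ P, IsPlateau k P ∧ Coincides P p m) ∧
      (∀ p m : ℕ, Reduced p m → 2 ≤ m → 1 ≤ p → region p m ⊆ square) ∧
      (∀ (k : ℕ) (P : Set (ℝ × ℝ)), 1 ≤ k → IsPlateau k P → (closure P ∩ xAxis).Nonempty →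
        ∃ p m : ℕ, Reduced p m ∧ 1 ≤ p ∧ IsSBRow k (p, m) ∧ Coincides P p m) ∧
      (IsSBRow 0 (0, 1) ∧ ∀ z ∈ E 0 1, delta z = 0)) := by
  refine ⟨⟨fun p m _ hp hm => isEllipse_E hp hm, isParabola_E, fun p m h => E_inter_xAxis h,
      fun p m h hp => ⟨fun z hz => ?_, ?_⟩⟩,
    ⟨fun p m q n h h' hne => disjoint_inside h h' hne, fun p m q n h h' hd => ?_⟩,
    fun p m q n h h' hd => ⟨E_inter_E h h' hd, tangentAt_tangencyPoint h h' hd⟩,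
    fun p m h hp => ?_, fun p m h hm hp => region_subset_square h hm hp,
    fun k P hk hP hcl => exists_coincides_of_closure hk hP hcl,
    ⟨by simp [sbArray], by simp⟩, fun z hz => delta_eq_zero hz⟩
  · exact (binForm_le_of_mem_region (by lia) h.snd_ne_zero hz).2.1
  · exact tangentAt_xAxis (by lia) h.snd_ne_zero
  · have hr := hd.reduced_add h h'
    have hpq := hd.add_ne_zero
    have hm := h.snd_ne_zero
    have hn := h'.snd_ne_zero
    exact ⟨hr, isEllipse_E (by lia) (by lia), region_add_subset_gap h h' hd,
      tangentAt_xAxis hpq hr.snd_ne_zero, ⟨_, tangentAt_tangencyPoint hr h hd.add_left⟩,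
      ⟨_, tangentAt_tangencyPoint hr h' hd.add_right⟩⟩
  · obtain ⟨k, hrow, hin, hco⟩ := exists_row_coincides h hp
    obtain ⟨z, hz, hzs⟩ := inside_inter_square_nonempty h hp
    have hlev : z ∈ levelSet k := ⟨hzs, hin z hz⟩
    exact ⟨k, hrow, hin, _, ⟨z, hlev, rfl⟩, hco z ⟨hlev, Or.inr hz⟩⟩
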